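/- Let $(\epsilon_i)_{i\in\mathbb{Z}}$ be i.i.d. real random variables with $\mathbb{E}\epsilon_0=0$, $\mathbb{E}\epsilon_0^2=1$ and $\mathbb{E}|\epsilon_0|^3<\infty$, and let $(\alpha_j)_{j\ge 0}$ be real numbers with $\sum_{j\ge 0}|\alpha_j|<\infty$ and $\sum_{j\ge 0}\alpha_j\neq 0$. For $k\in\mathbb{Z}$ let $X_k=\sum_{j\ge 0}\alpha_j\epsilon_{k-j}$ (the series converges absolutely almost surely), and put $s=\bigl|\sum_{j\ge 0}\alpha_j\bigr|$. Let $\Phi$ be the distribution function of $N(0,1)$ and, for $n\ge 1$, $$\Delta_n=\sup_{x\in\mathbb{R}}\Bigl|\mathbb{P}\Bigl(\sum_{k=1}^n X_k\le x\sqrt{n s^2}\Bigr)-\Phi(x)\Bigr|,\qquad R_n=n^{-1}\sum_{j\ge 1}\min(j,n)\,|\alpha_j| .$$ Then there is a constant $C$, depending only on $\sum_{j\ge 0}|\alpha_j|$, $s$ and $\mathbb{E}|\epsilon_0|^3$, such that $$\Delta_n\le C\bigl(n^{-1/2}+R_n\bigr)\qquad\text{for all } n\ge 1 .$$ Moreover,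 this bound is sharp up to a multiplicative constant: there exist linear processes $(X_k)$ satisfying all the above assumptions, one with $\sqrt{n}\,R_n\to\infty$ and another one with $(\sqrt{n}\,R_n)_{n\ge1}$ bounded, for each of which there is a constant $c>0$ with $$\Delta_n\ge c\bigl(n^{-1/2}+R_n\bigr)\qquad\text{for all } n\ge 1 .$$ -/

import Mathlib

open MeasureTheory ProbabilityTheory Filter

noncomputable section

/-- `(ε i)`, `i ∈ ℤ`, is an i.i.d. sequence of real random variables under `P` with mean zero,
unit variance and finite third absolute moment. (Almost everywhere measurability of each `ε i` is
part of `IdentDistrib`.) -/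
structure IsInnovationSequence {Ω : Type*} [MeasurableSpace Ω] (P : Measure Ω)
    (ε : ℤ → Ω → ℝ) : Prop where
  indep : iIndepFun ε P
  identDistrib : ∀ i, IdentDistrib (ε i) (ε 0) P P
  mean_eq_zero : ∫ ω, ε 0 ω ∂P = 0
  second_moment : ∫ ω, (ε 0 ω) ^ 2 ∂P = 1
  third_moment : Integrable (fun ω => |ε 0 ω| ^ 3) P

/-- Absolutely summable coefficients with non-zero sum. -/
structure IsAdmissibleCoeff (α : ℕ → ℝ) : Prop where
  summable_abs : Summable fun j => |α j|
  tsum_ne_zero : ∑' j, α j ≠ 0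

/-- The linear process `X_k = ∑_{j ≥ 0} α_j ε_{k-j}`. -/
def linearProcess {Ω : Type*} (α : ℕ → ℝ) (ε : ℤ → Ω → ℝ) (k : ℤ) (ω : Ω) : ℝ :=
  ∑' j : ℕ, α j * ε (k - (j : ℤ)) ω

/-- The partial sum `S_n = X_1 + ⋯ + X_n` of the linear process. -/
def partialSum {Ω : Type*} (α : ℕ → ℝ) (ε : ℤ → Ω → ℝ) (n : ℕ) (ω : Ω) : ℝ :=
  ∑ k ∈ Finset.Icc 1 n, linearProcess α ε (k : ℤ) ω

/-- The normalisation `s = |∑_{j ≥ 0} α_j|`. -/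
def longRunStd (α : ℕ → ℝ) : ℝ := |∑' j, α j|

/-- `sup_x |P(S_n ≤ x √(n s²)) - Φ(x)|`, with `Φ` the standard normal distribution function. -/
def normalDistance {Ω : Type*} [MeasurableSpace Ω] (P : Measure Ω) (α : ℕ → ℝ)
    (ε : ℤ → Ω → ℝ) (n : ℕ) : ℝ :=
  ⨆ x : ℝ, |P.real {ω | partialSum α ε n ω ≤ x * √((n : ℝ) * longRunStd α ^ 2)}
    - cdf (gaussianReal 0 1) x|

/-- `n⁻¹ ∑_{j ≥ 1} (j ∧ n) |α_j|`; the summation variable below is `j - 1`. -/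
def biasTerm (α : ℕ → ℝ) (n : ℕ) : ℝ :=
  (n : ℝ)⁻¹ * ∑' j : ℕ, min ((j : ℝ) + 1) (n : ℝ) * |α (j + 1)|

/-- The rate `n^{-1/2} + n⁻¹ ∑_{j ≥ 1} (j ∧ n) |α_j|`. -/
def rate (α : ℕ → ℝ) (n : ℕ) : ℝ := (n : ℝ) ^ (-(1 / 2) : ℝ) + biasTerm α n

/-- The bound is attained, up to a multiplicative constant, by the linear process with
coefficients `α` and innovations `ε`. -/
def AttainsRate {Ω : Type*} [MeasurableSpace Ω] (P : Measure Ω) (α : ℕ → ℝ)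
    (ε : ℤ → Ω → ℝ) : Prop :=
  ∃ c : ℝ, 0 < c ∧ ∀ n : ℕ, 1 ≤ n → c * rate α n ≤ normalDistance P α ε n

end

noncomputable section

open Set Topology

/-! Truncated at lag J, the partial sum S_n is a finite sum Σ b_i ε_i with |b_i| ≤ A = Σ|α_j| and
variance v = Σ b_i². Two errors compete. Comparing this sum with N(0, v) costs a multiple of E|ε_0|³
A/√v by Berry–Esseen, which is of order n^{-1/2}. Replacing v by n s² costs a multiple of |v/(n s²)
- 1|. When Σ b_i² is expanded, lags j and l share max(n - |j - l|, 0) indices, which falls short of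
n by at most min(j, n) + min(l, n); hence |n (Σ_{j<J} α_j)² - v| ≤ 2 A n R_n
(`abs_sub_windowVar_le`). Almost sure convergence as J → ∞ and continuity of Φ carry the bound over
to S_n (`abs_measureReal_sub_le_of_tendsto_ae`).

Berry–Esseen is proved by Stein's method. The solution of Stein's equation for the half-line (-∞, z]
is bounded and Lipschitz, and its derivative is locally Lipschitz except for a jump at z. Crossing
the jump costs the probability that a leave-one-out sum is close to z, which
`concentration_of_iIndepFun` controls.

For sharpness, each error is isolated. Integer valued sums have no mass between 0 and 1/2, while Φ
grows there by order n^{-1/2} after scaling; with X_k = ε_k the bias vanishes. Gaussian innovations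
have no Berry–Esseen error, and for nonnegative coefficients with α_0 = 1 the truncated variance
deficits are bounded below by quantities tending to n R_n, so Δ_n is at least of order R_n; slowly
decaying coefficients make R_n dominate n^{-1/2}. -/

/-- The density of the standard normal law. -/
def stdPDF (x : ℝ) : ℝ := gaussianPDFReal 0 1 x

/-- The distribution function of the standard normal law. -/
def stdCDF (x : ℝ) : ℝ := cdf (gaussianReal 0 1) x

/-! ### Normal density, distribution function and tail bounds. -/

lemma stdPDF_eq (x : ℝ) : stdPDF x = (√(2 * Real.pi))⁻¹ * Real.exp (-x ^ 2 / 2) := by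
  simp [stdPDF, gaussianPDFReal]

lemma stdPDF_pos (x : ℝ) : 0 < stdPDF x := gaussianPDFReal_pos 0 1 x one_ne_zero

lemma stdPDF_neg (x : ℝ) : stdPDF (-x) = stdPDF x := by simp [stdPDF_eq]

lemma hasDerivAt_stdPDF (x : ℝ) : HasDerivAt stdPDF (-x * stdPDF x) x := by
  have h : HasDerivAt (fun x : ℝ => (√(2 * Real.pi))⁻¹ * Real.exp (-x ^ 2 / 2))
      ((√(2 * Real.pi))⁻¹ * (Real.exp (-x ^ 2 / 2) * (-(2 * x) / 2))) x := by
    have h1 : HasDerivAt (fun x : ℝ => -x ^ 2 / 2) (-(2 * x) / 2) x := by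
      simpa using ((hasDerivAt_pow 2 x).neg.div_const 2)
    exact h1.exp.const_mul _
  rw [show stdPDF = fun x : ℝ => (√(2 * Real.pi))⁻¹ * Real.exp (-x ^ 2 / 2) from
    funext stdPDF_eq]
  convert h using 1
  ring

lemma continuous_stdPDF : Continuous stdPDF :=
  continuous_iff_continuousAt.2 fun x => (hasDerivAt_stdPDF x).continuousAt

lemma sqrt_two_pi_ge : 2 ≤ √(2 * Real.pi) := by
  apply Real.le_sqrt_of_sq_le
  nlinarith [Real.pi_gt_three]

lemma sqrt_two_pi_le : √(2 * Real.pi) ≤ 2.6 := by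
  rw [Real.sqrt_le_left (by norm_num)]
  nlinarith [Real.pi_lt_d2]

lemma stdPDF_le_half (x : ℝ) : stdPDF x ≤ 1 / 2 := by
  rw [stdPDF_eq]
  have h1 : (√(2 * Real.pi))⁻¹ ≤ 2⁻¹ := inv_anti₀ (by norm_num) sqrt_two_pi_ge
  have h2 : Real.exp (-x ^ 2 / 2) ≤ 1 := Real.exp_le_one_iff.2 (by nlinarith [sq_nonneg x])
  have h3 : 0 < Real.exp (-x ^ 2 / 2) := Real.exp_pos _
  nlinarith

lemma stdPDF_ge {x : ℝ} (hx : |x| ≤ 1) : 1 / 5 ≤ stdPDF x := by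
  rw [stdPDF_eq]
  have h1 : (2.6 : ℝ)⁻¹ ≤ (√(2 * Real.pi))⁻¹ :=
    inv_anti₀ (by linarith [sqrt_two_pi_ge]) sqrt_two_pi_le
  have hx2 : x ^ 2 ≤ 1 := by rw [← sq_abs]; nlinarith [abs_nonneg x]
  have h3 : Real.exp (-(1 / 2)) ≤ Real.exp (-x ^ 2 / 2) := Real.exp_le_exp.2 (by linarith)
  have h4 : (0.6 : ℝ) ≤ Real.exp (-(1 / 2)) := by
    rw [Real.exp_neg, ← one_div, le_div_iff₀ (Real.exp_pos _)]
    have : Real.exp (1 / 2) ^ 2 = Real.exp 1 := by rw [← Real.exp_nat_mul]; norm_num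
    nlinarith [Real.exp_one_lt_d9, Real.exp_pos (1 / 2)]
  calc (1 / 5 : ℝ) ≤ (2.6 : ℝ)⁻¹ * 0.6 := by norm_num
    _ ≤ _ := mul_le_mul h1 (h4.trans h3) (by norm_num) (by positivity)

lemma stdCDF_nonneg (x : ℝ) : 0 ≤ stdCDF x := cdf_nonneg _ x

lemma stdCDF_le_one (x : ℝ) : stdCDF x ≤ 1 := cdf_le_one _ x

lemma monotone_stdCDF : Monotone stdCDF := monotone_cdf _

lemma tendsto_stdCDF_atTop : Tendsto stdCDF atTop (𝓝 1) := tendsto_cdf_atTop _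

lemma tendsto_stdCDF_atBot : Tendsto stdCDF atBot (𝓝 0) := tendsto_cdf_atBot _

lemma stdCDF_eq_integral (x : ℝ) : stdCDF x = ∫ t in Iic x, stdPDF t := by
  rw [stdCDF, cdf_eq_real, Measure.real, gaussianReal_apply_eq_integral _ one_ne_zero,
    ENNReal.toReal_ofReal]
  · rfl
  · exact integral_nonneg fun t => gaussianPDFReal_nonneg 0 1 t

lemma integrable_stdPDF : Integrable stdPDF := integrable_gaussianPDFReal 0 1

lemma stdCDF_sub (x y : ℝ) : stdCDF y - stdCDF x = ∫ t in x..y, stdPDF t := by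
  rw [stdCDF_eq_integral, stdCDF_eq_integral,
    intervalIntegral.integral_Iic_sub_Iic integrable_stdPDF.integrableOn
      integrable_stdPDF.integrableOn]

lemma hasDerivAt_stdCDF (x : ℝ) : HasDerivAt stdCDF (stdPDF x) x := by
  have h : HasDerivAt (fun y => stdCDF 0 + ∫ t in (0 : ℝ)..y, stdPDF t) (stdPDF x) x :=
    (intervalIntegral.integral_hasDerivAt_right (continuous_stdPDF.intervalIntegrable _ _)
      (continuous_stdPDF.stronglyMeasurableAtFilter _ _)
      continuous_stdPDF.continuousAt).const_add _
  convert h using 1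
  funext y
  rw [← stdCDF_sub]
  ring

lemma continuous_stdCDF : Continuous stdCDF :=
  continuous_iff_continuousAt.2 fun x => (hasDerivAt_stdCDF x).continuousAt

lemma stdCDF_neg (x : ℝ) : stdCDF (-x) = 1 - stdCDF x := by
  have hd : ∀ y, HasDerivAt (fun y => stdCDF (-y) + stdCDF y) 0 y := fun y => by
    have h := ((hasDerivAt_stdCDF (-y)).comp y (hasDerivAt_neg y)).add (hasDerivAt_stdCDF y)
    refine HasDerivAt.congr_deriv h ?_
    rw [stdPDF_neg]; ring
  have hc : ∀ y, stdCDF (-y) + stdCDF y = stdCDF (-x) + stdCDF x := fun y =>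
    is_const_of_deriv_eq_zero (fun y => (hd y).differentiableAt) (fun y => (hd y).deriv) y x
  have ht : Tendsto (fun y => stdCDF (-y) + stdCDF y) atTop (𝓝 (0 + 1)) :=
    (tendsto_stdCDF_atBot.comp tendsto_neg_atTop_atBot).add tendsto_stdCDF_atTop
  simp only [hc] at ht
  have := tendsto_nhds_unique tendsto_const_nhds ht
  linarith

/-- Mills' inequality. -/
lemma mul_one_sub_stdCDF_le (x : ℝ) : x * (1 - stdCDF x) ≤ stdPDF x := by
  rcases le_or_gt x 0 with hx | hx
  · exact (mul_nonpos_of_nonpos_of_nonneg hx (by linarith [stdCDF_le_one x])).trans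
      (stdPDF_pos x).le
  -- The function 1 - Φ(y) - φ(y)/y increases on (0, ∞), with derivative φ(y)/y², and tends to 0 at
  -- infinity, so it is nonpositive there.
  have hd : ∀ y : ℝ, y ≠ 0 → HasDerivAt (fun y => (1 - stdCDF y) - stdPDF y / y)
      (stdPDF y / y ^ 2) y := fun y hy => by
    have h := ((hasDerivAt_stdCDF y).const_sub 1).sub
      ((hasDerivAt_stdPDF y).div (hasDerivAt_id y) hy)
    refine HasDerivAt.congr_deriv h ?_
    simp only [id]
    field_simp
    ring
  have hmono : MonotoneOn (fun y => (1 - stdCDF y) - stdPDF y / y) (Ioi 0) := by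
    apply monotoneOn_of_deriv_nonneg (convex_Ioi 0)
    · exact fun y hy => (hd y hy.ne').continuousAt.continuousWithinAt
    · rw [interior_Ioi]
      exact fun y hy => (hd y (ne_of_gt hy)).differentiableAt.differentiableWithinAt
    · rw [interior_Ioi]
      intro y hy
      rw [(hd y (ne_of_gt hy)).deriv]
      exact div_nonneg (stdPDF_pos y).le (sq_nonneg y)
  have ht : Tendsto (fun y => (1 - stdCDF y) - stdPDF y / y) atTop (𝓝 0) := by
    have h1 : Tendsto (fun y => stdPDF y / y) atTop (𝓝 0) := by
      refine squeeze_zero' (g := fun y => (1 / 2) / y) ?_ ?_ ?_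
      · filter_upwards [eventually_gt_atTop 0] with y hy using div_nonneg (stdPDF_pos y).le hy.le
      · filter_upwards [eventually_gt_atTop 0] with y hy
        have := stdPDF_le_half y
        gcongr
      · exact tendsto_const_nhds.div_atTop tendsto_id
    simpa using (tendsto_stdCDF_atTop.const_sub 1).sub h1
  have h := ge_of_tendsto ht (by
    filter_upwards [eventually_ge_atTop x] with y hy using hmono hx (hx.trans_le hy) hy)
  have h2 : 1 - stdCDF x ≤ stdPDF x / x := by linarith
  rwa [le_div_iff₀ hx, mul_comm] at h2

lemma neg_mul_stdCDF_le (x : ℝ) : -x * stdCDF x ≤ stdPDF x := by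
  have := mul_one_sub_stdCDF_le (-x)
  rw [stdCDF_neg, stdPDF_neg] at this
  simpa using this

lemma stdCDF_sub_ge {x y : ℝ} {m : ℝ} (hxy : x ≤ y) (hm : ∀ t ∈ Icc x y, m ≤ stdPDF t) :
    m * (y - x) ≤ stdCDF y - stdCDF x := by
  have := (convex_Icc x y).mul_sub_le_image_sub_of_le_deriv continuous_stdCDF.continuousOn
    (fun t _ => (hasDerivAt_stdCDF t).differentiableAt.differentiableWithinAt) (C := m)
    (fun t ht => by
      rw [(hasDerivAt_stdCDF t).deriv]; exact hm t (interior_subset ht))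
    x (left_mem_Icc.2 hxy) y (right_mem_Icc.2 hxy) hxy
  exact this

lemma abs_stdCDF_sub_le {x y : ℝ} {M : ℝ} (hM : ∀ t ∈ uIcc x y, stdPDF t ≤ M) :
    |stdCDF y - stdCDF x| ≤ M * |y - x| := by
  have := (convex_uIcc x y).norm_image_sub_le_of_norm_hasDerivWithin_le
    (fun t _ => (hasDerivAt_stdCDF t).hasDerivWithinAt) (C := M)
    (fun t ht => by rw [Real.norm_eq_abs, abs_of_pos (stdPDF_pos t)]; exact hM t ht)
    left_mem_uIcc right_mem_uIcc
  simpa using this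

/-! ### The solution of Stein's equation for a half-line -/

/-- The bounded solution of `f' w - w * f w = 1_{w ≤ z} - Φ z`. -/
def steinSol (z w : ℝ) : ℝ := (stdPDF w)⁻¹ * (stdCDF (min w z) * (1 - stdCDF (max w z)))

/-- The derivative of the Stein solution, as prescribed by Stein's equation. -/
def steinDeriv (z w : ℝ) : ℝ :=
  w * steinSol z w + (if w ≤ z then 1 else 0) - stdCDF z

lemma continuous_steinSol (z : ℝ) : Continuous (steinSol z) := by
  unfold steinSol
  have h1 := continuous_stdPDF
  have h2 := continuous_stdCDF
  exact (h1.inv₀ fun w => (stdPDF_pos w).ne').mul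
    ((h2.comp (continuous_id.min continuous_const)).mul
      (continuous_const.sub (h2.comp (continuous_id.max continuous_const))))

lemma measurable_steinDeriv (z : ℝ) : Measurable (steinDeriv z) := by
  unfold steinDeriv
  exact ((measurable_id.mul (continuous_steinSol z).measurable).add
    (Measurable.ite measurableSet_Iic measurable_const measurable_const)).sub measurable_const

lemma steinSol_nonneg (z w : ℝ) : 0 ≤ steinSol z w :=
  mul_nonneg (inv_nonneg.2 (stdPDF_pos w).le)
    (mul_nonneg (stdCDF_nonneg _) (by linarith [stdCDF_le_one (max w z)]))

/-- Monotonicity of Φ removes z. This bound is the useful one for w ≤ 0, its mirror image for w ≥ 0: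
on those half-lines Mills' inequality applies. -/
lemma steinSol_le_left (z w : ℝ) : steinSol z w ≤ (stdPDF w)⁻¹ * stdCDF w := by
  have h1 := monotone_stdCDF (min_le_left w z)
  have h2 := stdCDF_nonneg (min w z)
  have h3 := stdCDF_nonneg (max w z)
  have h4 := stdCDF_le_one (max w z)
  refine mul_le_mul_of_nonneg_left ?_ (inv_nonneg.2 (stdPDF_pos w).le)
  nlinarith

lemma steinSol_le_right (z w : ℝ) : steinSol z w ≤ (stdPDF w)⁻¹ * (1 - stdCDF w) := by
  have h1 := monotone_stdCDF (le_max_left w z)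
  have h2 := stdCDF_nonneg (min w z)
  have h3 := stdCDF_le_one (min w z)
  have h4 := stdCDF_le_one (max w z)
  refine mul_le_mul_of_nonneg_left ?_ (inv_nonneg.2 (stdPDF_pos w).le)
  nlinarith

lemma abs_mul_steinSol_le (z w : ℝ) : |w * steinSol z w| ≤ 1 := by
  have hp := stdPDF_pos w
  rw [abs_mul, abs_of_nonneg (steinSol_nonneg z w)]
  rcases le_total 0 w with hw | hw
  · rw [abs_of_nonneg hw]
    calc w * steinSol z w ≤ w * ((stdPDF w)⁻¹ * (1 - stdCDF w)) :=
          mul_le_mul_of_nonneg_left (steinSol_le_right z w) hw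
      _ = (w * (1 - stdCDF w)) / stdPDF w := by field_simp
      _ ≤ 1 := (div_le_one hp).2 (mul_one_sub_stdCDF_le w)
  · rw [abs_of_nonpos hw]
    calc -w * steinSol z w ≤ -w * ((stdPDF w)⁻¹ * stdCDF w) :=
          mul_le_mul_of_nonneg_left (steinSol_le_left z w) (by linarith)
      _ = (-w * stdCDF w) / stdPDF w := by field_simp
      _ ≤ 1 := (div_le_one hp).2 (neg_mul_stdCDF_le w)

/-- On [-1, 1] the density is at least 1/5, whence the 5; outside, divide the bound on w f(w) by |w|
≥ 1. -/
lemma abs_steinSol_le (z w : ℝ) : |steinSol z w| ≤ 5 := by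
  have h0 := steinSol_nonneg z w
  rcases le_total |w| 1 with hw | hw
  · rw [abs_of_nonneg h0]
    have hp := stdPDF_ge hw
    calc steinSol z w ≤ (stdPDF w)⁻¹ * stdCDF w := steinSol_le_left z w
      _ ≤ (1 / 5 : ℝ)⁻¹ * 1 := mul_le_mul (inv_anti₀ (by norm_num) hp) (stdCDF_le_one w)
          (stdCDF_nonneg w) (by norm_num)
      _ = 5 := by norm_num
  · have := abs_mul_steinSol_le z w
    rw [abs_mul] at this
    nlinarith [abs_nonneg (steinSol z w)]

lemma abs_steinDeriv_le (z w : ℝ) : |steinDeriv z w| ≤ 2 := by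
  have h := abs_le.1 (abs_mul_steinSol_le z w)
  have h1 := stdCDF_nonneg z
  have h2 := stdCDF_le_one z
  unfold steinDeriv
  rw [abs_le]
  split_ifs <;> constructor <;> linarith [h.1, h.2]

lemma hasDerivAt_inv_stdPDF (w : ℝ) :
    HasDerivAt (fun w => (stdPDF w)⁻¹) (w * (stdPDF w)⁻¹) w := by
  have hp := (stdPDF_pos w).ne'
  refine HasDerivAt.congr_deriv ((hasDerivAt_stdPDF w).inv hp) ?_
  field_simp

lemma hasDerivAt_inv_stdPDF_mul_stdCDF (z w : ℝ) :
    HasDerivAt (fun w => (stdPDF w)⁻¹ * (stdCDF w * (1 - stdCDF z)))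
      (w * ((stdPDF w)⁻¹ * (stdCDF w * (1 - stdCDF z))) + 1 - stdCDF z) w := by
  have hp := (stdPDF_pos w).ne'
  refine HasDerivAt.congr_deriv
    ((hasDerivAt_inv_stdPDF w).mul ((hasDerivAt_stdCDF w).mul_const (1 - stdCDF z))) ?_
  field_simp
  ring

lemma hasDerivAt_inv_stdPDF_mul_one_sub_stdCDF (z w : ℝ) :
    HasDerivAt (fun w => (stdPDF w)⁻¹ * (stdCDF z * (1 - stdCDF w)))
      (w * ((stdPDF w)⁻¹ * (stdCDF z * (1 - stdCDF w))) - stdCDF z) w := by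
  have hp := (stdPDF_pos w).ne'
  refine HasDerivAt.congr_deriv ((hasDerivAt_inv_stdPDF w).mul
    (((hasDerivAt_stdCDF w).const_sub 1).const_mul (stdCDF z))) ?_
  field_simp
  ring

lemma hasDerivAt_steinSol {z w : ℝ} (h : w ≠ z) :
    HasDerivAt (steinSol z) (steinDeriv z w) w := by
  rcases lt_or_gt_of_ne h with h | h
  · have h1 := hasDerivAt_inv_stdPDF_mul_stdCDF z w
    have h2 : steinSol z =ᶠ[𝓝 w] fun w => (stdPDF w)⁻¹ * (stdCDF w * (1 - stdCDF z)) := by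
      filter_upwards [Iio_mem_nhds h] with y hy
      simp [steinSol, min_eq_left (mem_Iio.1 hy).le, max_eq_right (mem_Iio.1 hy).le]
    refine (h1.congr_of_eventuallyEq h2).congr_deriv ?_
    simp [steinDeriv, h.le, h2.eq_of_nhds]
  · have h1 := hasDerivAt_inv_stdPDF_mul_one_sub_stdCDF z w
    have h2 : steinSol z =ᶠ[𝓝 w] fun w => (stdPDF w)⁻¹ * (stdCDF z * (1 - stdCDF w)) := by
      filter_upwards [Ioi_mem_nhds h] with y hy
      simp [steinSol, min_eq_right (mem_Ioi.1 hy).le, max_eq_left (mem_Ioi.1 hy).le]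
    refine (h1.congr_of_eventuallyEq h2).congr_deriv ?_
    simp [steinDeriv, not_le.2 h, h2.eq_of_nhds]

/-- The solution has a kink at z, where `steinDeriv` takes the left derivative. The right derivative
is what the mean value inequality needs in order to cross z in `abs_steinSol_sub_le`. -/
lemma hasDerivWithinAt_steinSol_self (z : ℝ) :
    HasDerivWithinAt (steinSol z) (z * steinSol z z - stdCDF z) (Ici z) z := by
  have h1 := (hasDerivAt_inv_stdPDF_mul_one_sub_stdCDF z z).hasDerivWithinAt (s := Ici z)
  have h2 : ∀ y ∈ Ici z, steinSol z y = (stdPDF y)⁻¹ * (stdCDF z * (1 - stdCDF y)) := by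
    intro y hy
    simp [steinSol, min_eq_right (show z ≤ y from hy), max_eq_left (show z ≤ y from hy)]
  have h3 := h1.congr h2 (h2 z self_mem_Ici)
  rwa [← h2 z self_mem_Ici] at h3

lemma abs_steinSol_sub_le (z a b : ℝ) : |steinSol z b - steinSol z a| ≤ 2 * |b - a| := by
  have key : ∀ a b : ℝ, a ≤ b → |steinSol z b - steinSol z a| ≤ 2 * |b - a| := by
    intro a b hab
    have := norm_image_sub_le_of_norm_deriv_right_le_segment (a := a) (b := b) (C := 2)
      (f := steinSol z)
      (f' := fun w => if w = z then z * steinSol z z - stdCDF z else steinDeriv z w)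
      (continuous_steinSol z).continuousOn (fun w _ => ?_) (fun w _ => ?_) b
      (right_mem_Icc.2 hab)
    · rwa [Real.norm_eq_abs, ← abs_of_nonneg (sub_nonneg.2 hab)] at this
    · by_cases h : w = z
      · subst h; simpa using hasDerivWithinAt_steinSol_self w
      · simpa [h] using (hasDerivAt_steinSol h).hasDerivWithinAt
    · by_cases h : w = z
      · have h0 := abs_le.1 (abs_mul_steinSol_le z z)
        have h1 := stdCDF_nonneg z
        have h2 := stdCDF_le_one z
        simp only [h, if_true, Real.norm_eq_abs, abs_le]
        constructor <;> linarith [h0.1, h0.2]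
      · simpa [h] using abs_steinDeriv_le z w
  rcases le_total a b with h | h
  · exact key a b h
  · rw [abs_sub_comm, abs_sub_comm b]; exact key b a h

lemma abs_mul_steinSol_sub_le (z w t : ℝ) :
    |(w + t) * steinSol z (w + t) - w * steinSol z w| ≤ |t| * (5 + 2 * |w|) := by
  have h1 := abs_steinSol_sub_le z w (w + t)
  have h2 := abs_steinSol_le z (w + t)
  calc |(w + t) * steinSol z (w + t) - w * steinSol z w|
      = |t * steinSol z (w + t) + w * (steinSol z (w + t) - steinSol z w)| := by ring_nf
    _ ≤ |t| * |steinSol z (w + t)| + |w| * |steinSol z (w + t) - steinSol z w| := by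
        rw [← abs_mul, ← abs_mul]; exact abs_add_le _ _
    _ ≤ |t| * 5 + |w| * (2 * |t|) := by
        rw [add_sub_cancel_left] at h1
        gcongr
    _ = _ := by ring

lemma ite_le_add_eq {z w t u : ℝ} (ht : |t| ≤ |u|) (h : |u| < |w - z|) :
    (if w + t ≤ z then (1 : ℝ) else 0) = if w ≤ z then 1 else 0 := by
  have h1 := abs_le.1 ht
  rcases lt_abs.1 h with h | h
  · rw [if_neg (by linarith [h1.1]), if_neg (by linarith [abs_nonneg u])]
  · rw [if_pos (by linarith [h1.2]), if_pos (by linarith [abs_nonneg u])]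

/-- By Stein's equation, f' varies like w f(w) plus the indicator of w ≤ z. If z is farther than |u|
from w the indicator is constant; otherwise the crude bound 2 + 2 = 4 is paid. -/
lemma abs_steinDeriv_sub_le (z w u : ℝ) :
    |steinDeriv z (w + u) - steinDeriv z w|
      ≤ |u| * (5 + 2 * |w|) + 4 * (if |w - z| ≤ |u| then 1 else 0) := by
  split_ifs with h
  · have h1 := abs_steinDeriv_le z (w + u)
    have h2 := abs_steinDeriv_le z w
    have h3 := abs_sub (steinDeriv z (w + u)) (steinDeriv z w)
    have : 0 ≤ |u| * (5 + 2 * |w|) := by positivity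
    linarith
  · have h1 := abs_mul_steinSol_sub_le z w u
    have h2 := ite_le_add_eq le_rfl (not_le.1 h)
    unfold steinDeriv
    rw [h2]
    convert h1 using 1
    · ring_nf
    · ring

/-- Away from the jump, the previous estimate is integrated along the segment from w to w + u; near
it, the Lipschitz constant 2 and the bound |f'| ≤ 2 suffice. -/
lemma abs_steinSol_taylor_le (z w u : ℝ) :
    |steinSol z (w + u) - steinSol z w - u * steinDeriv z w|
      ≤ |u| * (|u| * (5 + 2 * |w|) + 4 * (if |w - z| ≤ |u| then 1 else 0)) := by
  split_ifs with h
  · have h1 := abs_steinSol_sub_le z w (w + u)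
    rw [add_sub_cancel_left] at h1
    have h2 := abs_steinDeriv_le z w
    have h3 := abs_sub (steinSol z (w + u) - steinSol z w) (u * steinDeriv z w)
    rw [abs_mul] at h3
    have h5 : 0 ≤ |u| * (|u| * (5 + 2 * |w|)) := by positivity
    nlinarith [abs_nonneg u]
  · rw [not_le] at h
    have hmem : ∀ t ∈ uIcc w (w + u), |t - w| ≤ |u| := fun t ht => by
      simpa using abs_sub_left_of_mem_uIcc ht
    have hd : ∀ t ∈ uIcc w (w + u), HasDerivWithinAt (fun t => steinSol z t - t * steinDeriv z w)
        (steinDeriv z t - steinDeriv z w) (uIcc w (w + u)) t := fun t ht => by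
      have hne : t ≠ z := by
        rintro rfl
        have := hmem t ht
        rw [abs_sub_comm] at this
        linarith
      refine (HasDerivAt.congr_deriv ((hasDerivAt_steinSol hne).sub
        ((hasDerivAt_id t).mul_const (steinDeriv z w))) ?_).hasDerivWithinAt
      simp
    have hb : ∀ t ∈ uIcc w (w + u), ‖steinDeriv z t - steinDeriv z w‖ ≤ |u| * (5 + 2 * |w|) :=
      fun t ht => by
        have h1 := hmem t ht
        have h2 := abs_steinDeriv_sub_le z w (t - w)
        rw [if_neg (by linarith), add_sub_cancel] at h2
        rw [Real.norm_eq_abs]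
        refine h2.trans ?_
        rw [mul_zero, add_zero]
        gcongr
    have := (convex_uIcc w (w + u)).norm_image_sub_le_of_norm_hasDerivWithin_le hd hb
      left_mem_uIcc right_mem_uIcc
    rw [Real.norm_eq_abs, Real.norm_eq_abs, add_sub_cancel_left] at this
    calc _ = |steinSol z (w + u) - (w + u) * steinDeriv z w
          - (steinSol z w - w * steinDeriv z w)| := by ring_nf
      _ ≤ _ := this
      _ = _ := by ring

/-! ### Independent sums -/

section IndependentSums

set_option linter.unusedSectionVars false

variable {Ω : Type*} [MeasurableSpace Ω] {P : Measure Ω} [IsProbabilityMeasure P]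

lemma MeasureTheory.MemLp.integrable_abs_pow_three {X : Ω → ℝ} (hX : MemLp X 3 P) :
    Integrable (fun ω => |X ω| ^ 3) P := by
  have := hX.integrable_norm_pow (p := 3) (by norm_num)
  simpa [Real.norm_eq_abs] using this

lemma MeasureTheory.MemLp.memLp_two_of_three {X : Ω → ℝ} (hX : MemLp X 3 P) : MemLp X 2 P :=
  hX.mono_exponent (by norm_num)

lemma MeasureTheory.MemLp.integrable_of_three {X : Ω → ℝ} (hX : MemLp X 3 P) : Integrable X P :=
  hX.integrable (by norm_num)

lemma memLp_three_of_integrable {X : Ω → ℝ} (hX : AEStronglyMeasurable X P)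
    (h : Integrable (fun ω => |X ω| ^ 3) P) : MemLp X 3 P := by
  have h3 := (integrable_norm_rpow_iff hX (p := 3) (by norm_num) (by norm_num)).1
  apply h3
  refine h.congr (Eventually.of_forall fun ω => ?_)
  simp only [Real.norm_eq_abs]
  norm_num

/-- `E X² · E|X| ≤ E|X|³`. -/
lemma integral_sq_mul_integral_abs_le {X : Ω → ℝ} (hX : MemLp X 3 P) :
    (∫ ω, X ω ^ 2 ∂P) * ∫ ω, |X ω| ∂P ≤ ∫ ω, |X ω| ^ 3 ∂P := by
  set c := ∫ ω, |X ω| ∂P with hc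
  have i1 : Integrable (fun ω => |X ω|) P := hX.integrable_of_three.abs
  have i2 : Integrable (fun ω => X ω ^ 2) P := hX.memLp_two_of_three.integrable_sq
  have i3 := hX.integrable_abs_pow_three
  have hc0 : 0 ≤ c := integral_nonneg fun ω => abs_nonneg _
  -- This is (|X| + c)(|X| - c)² ≥ 0 expanded; with c = E|X| the terms in c³ cancel after
  -- integration.
  have hp : ∀ ω, X ω ^ 2 * c + c ^ 2 * |X ω| - c ^ 3 ≤ |X ω| ^ 3 := fun ω => by
    rw [← sq_abs (X ω)]
    nlinarith [mul_nonneg (add_nonneg (abs_nonneg (X ω)) hc0) (sq_nonneg (|X ω| - c))]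
  have i4 : Integrable (fun ω => X ω ^ 2 * c + c ^ 2 * |X ω|) P :=
    (i2.mul_const c).add (i1.const_mul (c ^ 2))
  have := integral_mono (i4.sub (integrable_const (c ^ 3))) i3 hp
  simp only [Pi.sub_apply] at this
  rw [integral_sub i4 (integrable_const _),
    integral_add (i2.mul_const c) (i1.const_mul _), integral_mul_const, integral_const_mul,
    ← hc, integral_const] at this
  simp only [probReal_univ, one_smul] at this
  linarith

/-- Either |x| ≤ 1/2, or x² ≤ 2|x|³. A third moment of at most 1/8 thus forces variance at most 1/2,
so removing one summand keeps half of a unit variance. -/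
lemma integral_sq_le_quarter_add {X : Ω → ℝ} (hX : MemLp X 3 P) :
    ∫ ω, X ω ^ 2 ∂P ≤ 1 / 4 + 2 * ∫ ω, |X ω| ^ 3 ∂P := by
  have i2 : Integrable (fun ω => X ω ^ 2) P := hX.memLp_two_of_three.integrable_sq
  have i3 := hX.integrable_abs_pow_three
  have hp : ∀ ω, X ω ^ 2 ≤ 1 / 4 + 2 * |X ω| ^ 3 := fun ω => by
    rw [← sq_abs (X ω)]
    have h0 := abs_nonneg (X ω)
    rcases le_total |X ω| (1 / 2) with h | h
    · have : 0 ≤ |X ω| ^ 3 := by positivity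
      nlinarith
    · nlinarith [mul_nonneg (sq_nonneg |X ω|) (sub_nonneg.2 h)]
  have := integral_mono i2 ((integrable_const (1 / 4)).add (i3.const_mul 2)) hp
  simp only [Pi.add_apply] at this
  rwa [integral_add (integrable_const _) (i3.const_mul 2), integral_const_mul, integral_const,
    probReal_univ, one_smul] at this

/-- Fubini with X frozen: it allows the concentration bound to be used with a random radius
independent of the sum. -/
lemma ProbabilityTheory.IndepFun.integral_comp_le {X Y : Ω → ℝ} (hXY : IndepFun X Y P)
    (hX : Measurable X)
    (hY : Measurable Y) {G : ℝ × ℝ → ℝ} (hG : Measurable G)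
    (hGi : Integrable (fun ω => G (X ω, Y ω)) P) {H : ℝ → ℝ} (hH : Measurable H)
    (hHi : Integrable (fun ω => H (X ω)) P) (h : ∀ x, ∫ ω, G (x, Y ω) ∂P ≤ H x) :
    ∫ ω, G (X ω, Y ω) ∂P ≤ ∫ ω, H (X ω) ∂P := by
  have hprod := (indepFun_iff_map_prod_eq_prod_map_map hX.aemeasurable hY.aemeasurable).1 hXY
  have : IsProbabilityMeasure (P.map Y) := Measure.isProbabilityMeasure_map hY.aemeasurable
  have : IsProbabilityMeasure (P.map X) := Measure.isProbabilityMeasure_map hX.aemeasurable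
  have hint : Integrable G ((P.map X).prod (P.map Y)) := by
    rw [← hprod]
    exact (integrable_map_measure hG.aestronglyMeasurable
      (hX.prodMk hY).aemeasurable).2 hGi
  calc ∫ ω, G (X ω, Y ω) ∂P = ∫ p, G p ∂(P.map fun ω => (X ω, Y ω)) :=
        (integral_map (hX.prodMk hY).aemeasurable hG.aestronglyMeasurable).symm
    _ = ∫ x, ∫ y, G (x, y) ∂(P.map Y) ∂(P.map X) := by rw [hprod, integral_prod _ hint]
    _ ≤ ∫ x, H x ∂(P.map X) := by
        refine integral_mono hint.integral_prod_left
          ((integrable_map_measure hH.aestronglyMeasurable hX.aemeasurable).2 hHi) fun x => ?_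
        simp only
        refine (integral_map hY.aemeasurable
          (hG.comp measurable_prodMk_left).aestronglyMeasurable).trans_le (h x)
    _ = ∫ ω, H (X ω) ∂P := integral_map hX.aemeasurable hH.aestronglyMeasurable

variable {ι : Type*} [DecidableEq ι] {ξ : ι → Ω → ℝ}

lemma ProbabilityTheory.iIndepFun.indepFun_sum_erase (hI : iIndepFun ξ P)
    (hm : ∀ i, Measurable (ξ i)) (s : Finset ι) (i : ι) :
    IndepFun (ξ i) (fun ω => ∑ j ∈ s.erase i, ξ j ω) P := by
  have := (hI.indepFun_finsetSum_of_notMem hm (s := s.erase i) (i := i) (by simp)).symm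
  convert this using 1
  funext ω
  simp

lemma integral_mul_comp_sum_erase (hI : iIndepFun ξ P) (hm : ∀ i, Measurable (ξ i))
    (s : Finset ι) (i : ι) {q ψ : ℝ → ℝ} (hq : Measurable q) (hψ : Measurable ψ) :
    ∫ ω, q (ξ i ω) * ψ (∑ j ∈ s.erase i, ξ j ω) ∂P
      = (∫ ω, q (ξ i ω) ∂P) * ∫ ω, ψ (∑ j ∈ s.erase i, ξ j ω) ∂P :=
  (hI.indepFun_sum_erase hm s i).integral_fun_comp_mul_comp (hm i).aemeasurable
    (Finset.measurable_sum _ fun j _ => hm j).aemeasurable hq.aestronglyMeasurable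
    hψ.aestronglyMeasurable

lemma integral_sum_sq (hI : iIndepFun ξ P) (h2 : ∀ i, MemLp (ξ i) 2 P)
    (h0 : ∀ i, ∫ ω, ξ i ω ∂P = 0) (s : Finset ι) :
    ∫ ω, (∑ i ∈ s, ξ i ω) ^ 2 ∂P = ∑ i ∈ s, ∫ ω, ξ i ω ^ 2 ∂P := by
  have hv := IndepFun.variance_sum (s := s) (fun i _ => h2 i)
    (fun i _ j _ hij => hI.indepFun hij)
  have hE : ∫ ω, (∑ i ∈ s, ξ i) ω ∂P = 0 := by
    simp only [Finset.sum_apply]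
    rw [integral_finsetSum _ fun i _ => (h2 i).integrable (by norm_num)]
    simp [h0]
  rw [variance_of_integral_eq_zero (memLp_finsetSum' s fun i _ => h2 i).aemeasurable hE] at hv
  simp only [Finset.sum_apply] at hv
  rw [hv]
  exact Finset.sum_congr rfl fun i _ =>
    variance_of_integral_eq_zero (h2 i).aemeasurable (h0 i)

lemma integral_abs_sum_le_one (hI : iIndepFun ξ P) (h2 : ∀ i, MemLp (ξ i) 2 P)
    (h0 : ∀ i, ∫ ω, ξ i ω ∂P = 0) (s : Finset ι) (hv : ∑ i ∈ s, ∫ ω, ξ i ω ^ 2 ∂P ≤ 1) :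
    ∫ ω, |∑ i ∈ s, ξ i ω| ∂P ≤ 1 := by
  have hL : MemLp (fun ω => ∑ i ∈ s, ξ i ω) 2 P := memLp_finsetSum s fun i _ => h2 i
  have hp : ∀ ω, |∑ i ∈ s, ξ i ω| ≤ ((∑ i ∈ s, ξ i ω) ^ 2 + 1) / 2 := fun ω => by
    rw [← sq_abs]
    nlinarith [sq_nonneg (|∑ i ∈ s, ξ i ω| - 1)]
  have i2 := hL.integrable_sq
  have := integral_mono (hL.integrable (by norm_num)).abs
    ((i2.add (integrable_const 1)).div_const 2) hp
  simp only [Pi.add_apply] at this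
  rw [integral_div, integral_add i2 (integrable_const 1), integral_sum_sq hI h2 h0] at this
  simp only [integral_const, probReal_univ, one_smul] at this
  linarith

/-! ### The concentration inequality. -/

/-- Clamping to `[-L, L]`. -/
def clamp (L x : ℝ) : ℝ := max (-L) (min L x)

lemma continuous_clamp (L : ℝ) : Continuous (clamp L) := by unfold clamp; fun_prop

lemma abs_clamp_le {L : ℝ} (hL : 0 ≤ L) (x : ℝ) : |clamp L x| ≤ L :=
  abs_le.2 ⟨le_max_left _ _, max_le (by linarith) (min_le_left _ _)⟩

lemma monotone_clamp (L : ℝ) : Monotone (clamp L) := fun _ _ h =>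
  max_le_max le_rfl (min_le_min le_rfl h)

lemma clamp_of_abs_le {L x : ℝ} (h : |x| ≤ L) : clamp L x = x := by
  have := abs_le.1 h
  rw [clamp, min_eq_right this.2, max_eq_right this.1]

lemma mul_clamp_sub_nonneg (L x u : ℝ) : 0 ≤ u * (clamp L x - clamp L (x - u)) := by
  rcases le_total 0 u with h | h
  · exact mul_nonneg h (sub_nonneg.2 (monotone_clamp L (by linarith)))
  · exact mul_nonneg_of_nonpos_of_nonpos h (sub_nonpos.2 (monotone_clamp L (by linarith)))

/-- For x in [-r, r] there is a margin δ before the clamp saturates on either side, so a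
displacement by u is registered at least up to min(|u|, δ). -/
lemma le_mul_clamp_sub {r δ x : ℝ} (hδ : 0 ≤ δ) (hx : |x| ≤ r) (u : ℝ) :
    |u| * min |u| δ ≤ u * (clamp (r + δ) x - clamp (r + δ) (x - u)) := by
  have hx' := abs_le.1 hx
  have hr := (abs_nonneg x).trans hx
  rw [clamp_of_abs_le (show |x| ≤ r + δ by linarith)]
  rcases le_total 0 u with h | h
  · rw [abs_of_nonneg h]
    refine mul_le_mul_of_nonneg_left ?_ h
    have : clamp (r + δ) (x - u) ≤ x - min u δ := by
      refine max_le ?_ ((min_le_right _ _).trans ?_)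
      · linarith [min_le_right u δ]
      · linarith [min_le_left u δ]
    linarith
  · rw [abs_of_nonpos h]
    have : x + min (-u) δ ≤ clamp (r + δ) (x - u) := by
      refine le_max_of_le_right (le_min ?_ ?_)
      · linarith [min_le_right (-u) δ]
      · linarith [min_le_left (-u) δ]
    nlinarith

/-- The concentration inequality for sums of independent random variables. -/
theorem concentration_of_iIndepFun (hI : iIndepFun ξ P) (hm : ∀ i, Measurable (ξ i))
    (h3 : ∀ i, MemLp (ξ i) 3 P) (h0 : ∀ i, ∫ ω, ξ i ω ∂P = 0) (s : Finset ι)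
    (hv : 1 / 2 ≤ ∑ i ∈ s, ∫ ω, ξ i ω ^ 2 ∂P) (hv1 : ∑ i ∈ s, ∫ ω, ξ i ω ^ 2 ∂P ≤ 1)
    {γ : ℝ} (hγ0 : 0 < γ) (hγ : ∑ i ∈ s, ∫ ω, |ξ i ω| ^ 3 ∂P ≤ γ) (m : ℝ) {r : ℝ}
    (hr : 0 ≤ r) :
    P.real {ω | |∑ i ∈ s, ξ i ω - m| ≤ r} ≤ 4 * r + 8 * γ := by
  have h2 : ∀ i, MemLp (ξ i) 2 P := fun i => (h3 i).memLp_two_of_three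
  have h1 : ∀ i, Integrable (ξ i) P := fun i => (h3 i).integrable_of_three
  set V : Ω → ℝ := fun ω => ∑ i ∈ s, ξ i ω with hV
  have hVm : Measurable V := Finset.measurable_sum _ fun j _ => hm j
  set A : Set Ω := {ω | |V ω - m| ≤ r} with hA
  have hAm : MeasurableSet A := measurableSet_le (hVm.sub_const m).abs measurable_const
  -- The test function is the clamp at level r + γ, centred at m. On A, its increments weighted by
  -- the ξ_i add up to at least Y = Σ |ξ_i| min(|ξ_i|, γ), which concentrates around e ≥ 1/4;
  -- everywhere their expectation is at most L. Hence P(A) e ≤ L + γ.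
  set L := r + γ with hL
  have hL0 : 0 ≤ L := by positivity
  set g : ℝ → ℝ := fun u => |u| * min |u| γ with hg
  have hgm : Measurable g := by fun_prop
  have hg0 : ∀ u, 0 ≤ g u := fun u => mul_nonneg (abs_nonneg u) (le_min (abs_nonneg u) hγ0.le)
  have hgle : ∀ u, g u ≤ γ * |u| := fun u => by
    rw [mul_comm γ]; exact mul_le_mul_of_nonneg_left (min_le_right _ _) (abs_nonneg u)
  have hY2 : ∀ i, MemLp (fun ω => g (ξ i ω)) 2 P := fun i =>
    ((h2 i).abs.const_mul γ).of_le (hgm.comp (hm i)).aestronglyMeasurable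
      (Eventually.of_forall fun ω => by
        have : 0 ≤ γ * |ξ i ω| := (hg0 _).trans (hgle _)
        simpa [Real.norm_eq_abs, abs_of_nonneg (hg0 _), abs_of_pos hγ0] using hgle (ξ i ω))
  set Y : Ω → ℝ := fun ω => ∑ i ∈ s, g (ξ i ω) with hY
  have hYL : MemLp Y 2 P := memLp_finsetSum s fun i _ => hY2 i
  set e := ∫ ω, Y ω ∂P with he
  -- the mean of `Y`
  have he4 : 1 / 4 ≤ e := by
    have hb : ∀ i, (∫ ω, ξ i ω ^ 2 ∂P) - (1 / (4 * γ)) * ∫ ω, |ξ i ω| ^ 3 ∂P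
        ≤ ∫ ω, g (ξ i ω) ∂P := fun i => by
      rw [← integral_const_mul, ← integral_sub (h2 i).integrable_sq
        ((h3 i).integrable_abs_pow_three.const_mul _)]
      refine integral_mono ((h2 i).integrable_sq.sub
        ((h3 i).integrable_abs_pow_three.const_mul _)) ((hY2 i).integrable (by norm_num))
        fun ω => ?_
      simp only [hg]
      rw [← sq_abs]
      set x := |ξ i ω|
      have hx : 0 ≤ x := abs_nonneg _
      -- The bound by γ is (2γ - x)² ≥ 0. The factor 1/(4γ) makes the third moments cost at most 1/4
      -- out of the variance 1/2.
      have : x - 1 / (4 * γ) * x ^ 2 ≤ min x γ := by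
        apply le_min
        · have : 0 ≤ 1 / (4 * γ) * x ^ 2 := by positivity
          linarith
        · have : γ - (x - 1 / (4 * γ) * x ^ 2) = (2 * γ - x) ^ 2 / (4 * γ) := by
            field_simp; ring
          have h5 : 0 ≤ (2 * γ - x) ^ 2 / (4 * γ) := by positivity
          linarith
      nlinarith
    have hsum := Finset.sum_le_sum fun i (_ : i ∈ s) => hb i
    rw [Finset.sum_sub_distrib, ← Finset.mul_sum,
      ← integral_finsetSum _ fun i _ => (hY2 i).integrable (by norm_num)] at hsum
    have h5 : 1 / (4 * γ) * ∑ i ∈ s, ∫ ω, |ξ i ω| ^ 3 ∂P ≤ 1 / (4 * γ) * γ :=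
      mul_le_mul_of_nonneg_left hγ (by positivity)
    have h6 : 1 / (4 * γ) * γ = 1 / 4 := by field_simp
    linarith
  -- the variance of `Y`
  have hvar : ∫ ω, (Y ω - e) ^ 2 ∂P ≤ γ ^ 2 := by
    have hv' := IndepFun.variance_sum (s := s) (fun i _ => hY2 i)
      (fun i _ j _ hij => (hI.indepFun hij).comp hgm hgm)
    have hYe : (∑ i ∈ s, fun ω => g (ξ i ω)) = Y := by funext ω; simp [hY]
    rw [hYe, variance_eq_integral hYL.aemeasurable] at hv'
    rw [hv']
    calc ∑ i ∈ s, variance (fun ω => g (ξ i ω)) P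
        ≤ ∑ i ∈ s, γ ^ 2 * ∫ ω, ξ i ω ^ 2 ∂P := by
          refine Finset.sum_le_sum fun i _ => ?_
          refine (variance_le_expectation_sq (hY2 i).aestronglyMeasurable).trans ?_
          rw [← integral_const_mul]
          refine integral_mono (hY2 i).integrable_sq ((h2 i).integrable_sq.const_mul _)
            fun ω => ?_
          simp only [Pi.pow_apply]
          rw [← sq_abs (ξ i ω), ← mul_pow]
          exact pow_le_pow_left₀ (hg0 _) (hgle _) 2
      _ = γ ^ 2 * ∑ i ∈ s, ∫ ω, ξ i ω ^ 2 ∂P := by rw [Finset.mul_sum]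
      _ ≤ γ ^ 2 := by nlinarith [sq_nonneg γ]
  -- the pointwise inequality
  have hpt : ∀ ω, A.indicator (fun _ => e) ω ≤ L * ((V ω ^ 2 + 1) / 2)
      - ∑ i ∈ s, ξ i ω * clamp L (∑ j ∈ s.erase i, ξ j ω - m)
      + ((Y ω - e) ^ 2 / γ + γ) / 2 := fun ω => by
    have hid : ∑ i ∈ s, ξ i ω * (clamp L (V ω - m) - clamp L (V ω - m - ξ i ω))
        = V ω * clamp L (V ω - m)
          - ∑ i ∈ s, ξ i ω * clamp L (∑ j ∈ s.erase i, ξ j ω - m) := by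
      simp only [mul_sub, Finset.sum_sub_distrib, hV, Finset.sum_mul]
      congr 1
      refine Finset.sum_congr rfl fun i hi => ?_
      rw [← Finset.add_sum_erase s _ hi]
      ring_nf
    have hcl : V ω * clamp L (V ω - m) ≤ L * ((V ω ^ 2 + 1) / 2) := by
      calc V ω * clamp L (V ω - m) ≤ |V ω| * |clamp L (V ω - m)| := by
            rw [← abs_mul]; exact le_abs_self _
        _ ≤ |V ω| * L := mul_le_mul_of_nonneg_left (abs_clamp_le hL0 _) (abs_nonneg _)
        _ ≤ L * ((V ω ^ 2 + 1) / 2) := by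
            rw [mul_comm]
            refine mul_le_mul_of_nonneg_left ?_ hL0
            rw [← sq_abs]
            nlinarith [sq_nonneg (|V ω| - 1)]
    -- Young's inequality with weight γ, matched to Var Y ≤ γ², so that the fluctuation of Y costs γ
    -- in the mean.
    have hq : e - Y ω ≤ ((Y ω - e) ^ 2 / γ + γ) / 2 := by
      have h5 : ((Y ω - e) ^ 2 / γ + γ) / 2 - (e - Y ω) = (Y ω - e + γ) ^ 2 / (2 * γ) := by
        field_simp; ring
      have h6 : 0 ≤ (Y ω - e + γ) ^ 2 / (2 * γ) := by positivity
      linarith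
    by_cases hω : ω ∈ A
    · rw [indicator_of_mem hω]
      have : Y ω ≤ ∑ i ∈ s, ξ i ω * (clamp L (V ω - m) - clamp L (V ω - m - ξ i ω)) :=
        Finset.sum_le_sum fun i _ => le_mul_clamp_sub hγ0.le hω (ξ i ω)
      linarith
    · rw [indicator_of_notMem hω]
      have : 0 ≤ ∑ i ∈ s, ξ i ω * (clamp L (V ω - m) - clamp L (V ω - m - ξ i ω)) :=
        Finset.sum_nonneg fun i _ => mul_clamp_sub_nonneg L (V ω - m) (ξ i ω)
      have h5 : 0 ≤ ((Y ω - e) ^ 2 / γ + γ) / 2 := by positivity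
      linarith
  -- integration
  have hVL : MemLp V 2 P := memLp_finsetSum s fun i _ => h2 i
  have hcm : Measurable fun x => clamp L (x - m) :=
    (continuous_clamp L).measurable.comp (measurable_id.sub_const m)
  have I1 : Integrable (fun ω => L * ((V ω ^ 2 + 1) / 2)) P :=
    ((hVL.integrable_sq.add (integrable_const 1)).div_const 2).const_mul L
  have I2 : ∀ i ∈ s,
      Integrable (fun ω => ξ i ω * clamp L (∑ j ∈ s.erase i, ξ j ω - m)) P := fun i _ =>
    (h1 i).mul_bdd (c := L)
      (hcm.comp (Finset.measurable_sum _ fun j _ => hm j)).aestronglyMeasurable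
      (Eventually.of_forall fun ω => abs_clamp_le hL0 _)
  have I2' := integrable_finsetSum s I2
  have I3 : Integrable (fun ω => (Y ω - e) ^ 2) P :=
    (hYL.sub (memLp_const e)).integrable_sq
  have I4 : Integrable (fun ω => ((Y ω - e) ^ 2 / γ + γ) / 2) P :=
    ((I3.div_const γ).add (integrable_const γ)).div_const 2
  have I12 : Integrable (fun ω => L * ((V ω ^ 2 + 1) / 2)
      - ∑ i ∈ s, ξ i ω * clamp L (∑ j ∈ s.erase i, ξ j ω - m)) P := I1.sub I2'
  have hfin := integral_mono ((integrable_const e).indicator hAm) (I12.add I4) hpt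
  simp only [Pi.add_apply] at hfin
  rw [integral_indicator_const e hAm, integral_add I12 I4, integral_sub I1 I2',
    integral_finsetSum s I2, integral_const_mul, integral_div, integral_div,
    integral_add hVL.integrable_sq (integrable_const 1),
    integral_add (I3.div_const γ) (integrable_const γ), integral_div, integral_sum_sq hI h2 h0]
    at hfin
  -- The clamp of the leave-one-out sum is independent of the centred variable ξ_i.
  have hz : ∑ i ∈ s, ∫ ω, ξ i ω * clamp L (∑ j ∈ s.erase i, ξ j ω - m) ∂P = 0 :=
    Finset.sum_eq_zero fun i _ => by
      refine (integral_mul_comp_sum_erase hI hm s i measurable_id hcm).trans ?_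
      simp [h0]
  rw [hz] at hfin
  simp only [integral_const, probReal_univ, smul_eq_mul, mul_one, one_mul] at hfin
  have h7 : (∫ ω, (Y ω - e) ^ 2 ∂P) / γ ≤ γ := by
    rw [div_le_iff₀ hγ0]; nlinarith
  have h8 : P.real A * (1 / 4) ≤ P.real A * e :=
    mul_le_mul_of_nonneg_left he4 measureReal_nonneg
  have h9 : L * ((∑ i ∈ s, ∫ ω, ξ i ω ^ 2 ∂P + 1) / 2) ≤ L * 1 :=
    mul_le_mul_of_nonneg_left (by linarith) hL0
  linarith

end IndependentSums

/-! ### The Berry–Esseen theorem by Stein's method. -/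

section BerryEsseen

set_option linter.unusedSectionVars false

variable {Ω : Type*} [MeasurableSpace Ω] {P : Measure Ω} [IsProbabilityMeasure P]
  {ι : Type*} [DecidableEq ι] {ξ : ι → Ω → ℝ}

/-- The contribution of one summand in Stein's method. -/
lemma abs_integral_stein_summand_le (hI : iIndepFun ξ P) (hm : ∀ i, Measurable (ξ i))
    (h3 : ∀ i, MemLp (ξ i) 3 P) (h0 : ∀ i, ∫ ω, ξ i ω ∂P = 0) {s : Finset ι}
    (hv : ∑ i ∈ s, ∫ ω, ξ i ω ^ 2 ∂P = 1)
    {γ : ℝ} (hγ0 : 0 < γ) (hγ : ∑ i ∈ s, ∫ ω, |ξ i ω| ^ 3 ∂P ≤ γ) (hγ8 : γ ≤ 1 / 8) (z : ℝ)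
    {i : ι} (hi : i ∈ s) :
    |∫ ω, ((∫ ω', ξ i ω' ^ 2 ∂P) * steinDeriv z (∑ j ∈ s, ξ j ω)
        - ξ i ω * steinSol z (∑ j ∈ s, ξ j ω)) ∂P|
      ≤ 46 * (∫ ω, |ξ i ω| ^ 3 ∂P) + 64 * γ * ∫ ω, ξ i ω ^ 2 ∂P := by
  have h2 : ∀ i, MemLp (ξ i) 2 P := fun i => (h3 i).memLp_two_of_three
  have h1 : ∀ i, Integrable (ξ i) P := fun i => (h3 i).integrable_of_three
  set σ2 := ∫ ω', ξ i ω' ^ 2 ∂P with hσ2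
  set β := ∫ ω, |ξ i ω| ^ 3 ∂P with hβ
  have hσ0 : 0 ≤ σ2 := integral_nonneg fun ω => sq_nonneg _
  set U : Ω → ℝ := fun ω => ∑ j ∈ s.erase i, ξ j ω with hU
  have hUm : Measurable U := Finset.measurable_sum _ fun j _ => hm j
  have hsplit : ∀ ω, ∑ j ∈ s, ξ j ω = U ω + ξ i ω := fun ω =>
    (Finset.sum_erase_add s _ hi).symm
  have hUL : MemLp U 2 P := memLp_finsetSum _ fun i _ => h2 i
  have hind : IndepFun (ξ i) U P := hI.indepFun_sum_erase hm s i
  have hβle : β ≤ γ := le_trans (Finset.single_le_sum (f := fun i => ∫ ω, |ξ i ω| ^ 3 ∂P)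
    (fun i _ => integral_nonneg fun ω => by positivity) hi) hγ
  have hve : σ2 + ∑ j ∈ s.erase i, ∫ ω, ξ j ω ^ 2 ∂P = 1 := by
    rw [← hv]; exact Finset.add_sum_erase s (fun j => ∫ ω, ξ j ω ^ 2 ∂P) hi
  have hσhalf : σ2 ≤ 1 / 2 := by
    have := integral_sq_le_quarter_add (h3 i)
    linarith
  have hγe : ∑ j ∈ s.erase i, ∫ ω, |ξ j ω| ^ 3 ∂P ≤ γ :=
    le_trans (Finset.sum_le_sum_of_subset_of_nonneg (Finset.erase_subset i s)
      fun j _ _ => integral_nonneg fun ω => by positivity) hγ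
  have hconc : ∀ r : ℝ, 0 ≤ r → P.real {ω | |U ω - z| ≤ r} ≤ 4 * r + 8 * γ := fun r hr =>
    concentration_of_iIndepFun hI hm h3 h0 (s.erase i) (by linarith) (by linarith) hγ0 hγe z hr
  have hUabs : ∫ ω, |U ω| ∂P ≤ 1 := integral_abs_sum_le_one hI h2 h0 _ (by linarith)
  -- integrability
  have hfm := (continuous_steinSol z).measurable
  have hDm := measurable_steinDeriv z
  have J1 : Integrable (fun ω => σ2 * steinDeriv z (U ω + ξ i ω)) P :=
    (Integrable.of_bound (hDm.comp (hUm.add (hm i))).aestronglyMeasurable 2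
      (Eventually.of_forall fun ω => abs_steinDeriv_le z _)).const_mul _
  have J2 : Integrable (fun ω => σ2 * steinDeriv z (U ω)) P :=
    (Integrable.of_bound (hDm.comp hUm).aestronglyMeasurable 2
      (Eventually.of_forall fun ω => abs_steinDeriv_le z _)).const_mul _
  have J3 : Integrable (fun ω => ξ i ω * steinSol z (U ω + ξ i ω)) P :=
    (h1 i).mul_bdd (c := 5) (hfm.comp (hUm.add (hm i))).aestronglyMeasurable
      (Eventually.of_forall fun ω => abs_steinSol_le z _)
  have J4 : Integrable (fun ω => ξ i ω * steinSol z (U ω)) P :=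
    (h1 i).mul_bdd (c := 5) (hfm.comp hUm).aestronglyMeasurable
      (Eventually.of_forall fun ω => abs_steinSol_le z _)
  have J5 : Integrable (fun ω => ξ i ω ^ 2 * steinDeriv z (U ω)) P :=
    (h2 i).integrable_sq.mul_bdd (c := 2) (hDm.comp hUm).aestronglyMeasurable
      (Eventually.of_forall fun ω => abs_steinDeriv_le z _)
  -- Independence of ξ_i and U permits subtracting the Taylor terms at U at no cost in the mean;
  -- only increments of f' and second-order remainders of f are left in T.
  have e4 : ∫ ω, ξ i ω * steinSol z (U ω) ∂P = 0 := by
    refine (integral_mul_comp_sum_erase hI hm s i measurable_id hfm).trans ?_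
    simp [h0]
  have e5 : ∫ ω, ξ i ω ^ 2 * steinDeriv z (U ω) ∂P = ∫ ω, σ2 * steinDeriv z (U ω) ∂P := by
    rw [integral_const_mul]
    exact integral_mul_comp_sum_erase hI hm s i (measurable_id.pow_const 2) hDm
  set T : Ω → ℝ := fun ω => σ2 * (steinDeriv z (U ω + ξ i ω) - steinDeriv z (U ω))
    - ξ i ω * (steinSol z (U ω + ξ i ω) - steinSol z (U ω) - ξ i ω * steinDeriv z (U ω)) with hT
  have hTid : ∫ ω, (σ2 * steinDeriv z (∑ j ∈ s, ξ j ω) - ξ i ω * steinSol z (∑ j ∈ s, ξ j ω)) ∂P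
      = ∫ ω, T ω ∂P := by
    have K1 : Integrable (fun ω => σ2 * steinDeriv z (U ω + ξ i ω)
      - ξ i ω * steinSol z (U ω + ξ i ω)) P := J1.sub J3
    have K2 : Integrable (fun ω => ξ i ω * steinSol z (U ω)
      + ξ i ω ^ 2 * steinDeriv z (U ω)) P := J4.add J5
    have K3 : Integrable (fun ω => σ2 * steinDeriv z (U ω + ξ i ω)
      - ξ i ω * steinSol z (U ω + ξ i ω) - σ2 * steinDeriv z (U ω)) P := K1.sub J2
    have : T = fun ω => σ2 * steinDeriv z (U ω + ξ i ω) - ξ i ω * steinSol z (U ω + ξ i ω)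
        - σ2 * steinDeriv z (U ω)
        + (ξ i ω * steinSol z (U ω) + ξ i ω ^ 2 * steinDeriv z (U ω)) := by
      funext ω; simp only [hT]; ring
    rw [this, integral_add K3 K2, integral_sub K1 J2, integral_add J4 J5, e4, e5]
    simp only [hsplit]
    ring
  rw [hTid]
  -- the bound on the integrand
  set G : ℝ × ℝ → ℝ := fun p => (σ2 + p.1 ^ 2) *
    (|p.1| * (5 + 2 * |p.2|) + 4 * (if |p.2 - z| ≤ |p.1| then 1 else 0)) with hG
  have hGm : Measurable G := by
    have : Measurable fun p : ℝ × ℝ => (if |p.2 - z| ≤ |p.1| then (1 : ℝ) else 0) :=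
      Measurable.ite (measurableSet_le (by fun_prop) (by fun_prop)) measurable_const
        measurable_const
    fun_prop
  have hTG : ∀ ω, |T ω| ≤ G (ξ i ω, U ω) := fun ω => by
    have b1 := abs_steinDeriv_sub_le z (U ω) (ξ i ω)
    have b2 := abs_steinSol_taylor_le z (U ω) (ξ i ω)
    have b3 := abs_sub (σ2 * (steinDeriv z (U ω + ξ i ω) - steinDeriv z (U ω)))
      (ξ i ω * (steinSol z (U ω + ξ i ω) - steinSol z (U ω) - ξ i ω * steinDeriv z (U ω)))
    rw [abs_mul, abs_mul, abs_of_nonneg hσ0] at b3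
    refine b3.trans ?_
    have b4 := mul_le_mul_of_nonneg_left b1 hσ0
    have b5 := mul_le_mul_of_nonneg_left b2 (abs_nonneg (ξ i ω))
    rw [← mul_assoc, ← sq, sq_abs] at b5
    simp only [hG]
    linarith
  have hq1 : Integrable (fun ω => (σ2 + ξ i ω ^ 2) * |ξ i ω|) P := by
    have := ((h1 i).abs.const_mul σ2).add (h3 i).integrable_abs_pow_three
    refine this.congr (Eventually.of_forall fun ω => ?_)
    simp only [Pi.add_apply]
    rw [pow_succ, sq_abs]; ring
  have hq2 : Integrable (fun ω => σ2 + ξ i ω ^ 2) P :=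
    (integrable_const σ2).add (h2 i).integrable_sq
  have hindic : Measurable fun ω => (if |U ω - z| ≤ |ξ i ω| then (1 : ℝ) else 0) :=
    Measurable.ite (measurableSet_le (hUm.sub_const z).abs (hm i).abs) measurable_const
      measurable_const
  have hGi : Integrable (fun ω => G (ξ i ω, U ω)) P := by
    have g1 : Integrable (fun ω => ((σ2 + ξ i ω ^ 2) * |ξ i ω|) * (5 + 2 * |U ω|)) P := by
      have hi' : IndepFun (fun ω => (σ2 + ξ i ω ^ 2) * |ξ i ω|) (fun ω => 5 + 2 * |U ω|) P :=
        hind.comp (φ := fun x => (σ2 + x ^ 2) * |x|) (ψ := fun x => 5 + 2 * |x|)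
          (by fun_prop) (by fun_prop)
      exact hi'.integrable_mul hq1
        ((integrable_const 5).add ((hUL.integrable (by norm_num)).abs.const_mul 2))
    have g2 : Integrable (fun ω => (σ2 + ξ i ω ^ 2) *
        (if |U ω - z| ≤ |ξ i ω| then (1 : ℝ) else 0)) P :=
      hq2.mul_bdd (c := 1) hindic.aestronglyMeasurable
        (Eventually.of_forall fun ω => by split_ifs <;> simp)
    refine (g1.add (g2.const_mul 4)).congr (Eventually.of_forall fun ω => ?_)
    simp only [hG, Pi.add_apply]
    ring
  -- For fixed x, E|U| ≤ 1 gives 7|x| and concentration gives 4(4|x| + 8γ), in total 23|x| + 32γ.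
  -- Integrating against σ² + ξ_i² doubles both constants, since σ² E|ξ_i| ≤ E|ξ_i|³.
  set H : ℝ → ℝ := fun x => (σ2 + x ^ 2) * (23 * |x| + 32 * γ) with hH
  have hHeq : ∀ x, H x = 23 * ((σ2 + x ^ 2) * |x|) + 32 * γ * (σ2 + x ^ 2) := fun x => by
    simp only [hH]; ring
  have hHi : Integrable (fun ω => H (ξ i ω)) P := by
    simp only [hHeq]
    exact (hq1.const_mul 23).add (hq2.const_mul (32 * γ))
  have hGH : ∀ x, ∫ ω, G (x, U ω) ∂P ≤ H x := fun x => by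
    have m1 : MeasurableSet {ω | |U ω - z| ≤ |x|} :=
      measurableSet_le (hUm.sub_const z).abs measurable_const
    have m2 : ∀ ω, (if |U ω - z| ≤ |x| then (1 : ℝ) else 0)
        = {ω | |U ω - z| ≤ |x|}.indicator (fun _ => 1) ω := fun ω => by
      simp [indicator]
    have u1 : Integrable (fun ω => |U ω|) P := (hUL.integrable (by norm_num)).abs
    have u2 : Integrable ({ω | |U ω - z| ≤ |x|}.indicator fun _ => (1 : ℝ)) P :=
      (integrable_const 1).indicator m1
    have u3 : Integrable (fun ω => |x| * (5 + 2 * |U ω|)) P :=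
      ((integrable_const 5).add (u1.const_mul 2)).const_mul _
    simp only [hG, hH, m2]
    rw [integral_const_mul, integral_add u3 (u2.const_mul 4), integral_const_mul,
      integral_const_mul, integral_add (integrable_const 5) (u1.const_mul 2),
      integral_const_mul, integral_indicator_const _ m1]
    simp only [integral_const, probReal_univ, smul_eq_mul, mul_one, one_mul]
    have := hconc |x| (abs_nonneg x)
    refine mul_le_mul_of_nonneg_left ?_ (by positivity)
    nlinarith [abs_nonneg x]
  have hfinal := hind.integral_comp_le (hm i) hUm hGm hGi (by fun_prop) hHi hGH
  have hHint : ∫ ω, H (ξ i ω) ∂P ≤ 46 * β + 64 * γ * σ2 := by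
    simp only [hHeq]
    rw [integral_add (hq1.const_mul 23) (hq2.const_mul (32 * γ)), integral_const_mul,
      integral_const_mul, integral_add (integrable_const σ2) (h2 i).integrable_sq,
      integral_const, probReal_univ, one_smul]
    have : ∫ ω, (σ2 + ξ i ω ^ 2) * |ξ i ω| ∂P = σ2 * (∫ ω, |ξ i ω| ∂P) + β := by
      rw [hβ, ← integral_const_mul, ← integral_add ((h1 i).abs.const_mul σ2)
        (h3 i).integrable_abs_pow_three]
      refine integral_congr_ae (Eventually.of_forall fun ω => ?_)
      simp only
      rw [pow_succ |ξ i ω|, sq_abs]; ring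
    rw [this]
    have := integral_sq_mul_integral_abs_le (h3 i)
    linarith
  calc |∫ ω, T ω ∂P| ≤ ∫ ω, |T ω| ∂P := abs_integral_le_integral_abs
    _ ≤ ∫ ω, G (ξ i ω, U ω) ∂P :=
        integral_mono_of_nonneg (Eventually.of_forall fun ω => abs_nonneg _) hGi
          (Eventually.of_forall hTG)
    _ ≤ _ := hfinal.trans hHint

/-- The Berry–Esseen theorem for independent summands with total variance one. -/
theorem berry_esseen_of_sum_variance_eq_one (hI : iIndepFun ξ P) (hm : ∀ i, Measurable (ξ i))
    (h3 : ∀ i, MemLp (ξ i) 3 P) (h0 : ∀ i, ∫ ω, ξ i ω ∂P = 0) (s : Finset ι)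
    (hv : ∑ i ∈ s, ∫ ω, ξ i ω ^ 2 ∂P = 1)
    {γ : ℝ} (hγ0 : 0 < γ) (hγ : ∑ i ∈ s, ∫ ω, |ξ i ω| ^ 3 ∂P ≤ γ) (z : ℝ) :
    |P.real {ω | ∑ i ∈ s, ξ i ω ≤ z} - stdCDF z| ≤ 110 * γ := by
  -- For γ > 1/8 the claimed bound exceeds 1.
  rcases lt_or_ge (1 / 8) γ with hγ8 | hγ8
  · have a1 : P.real {ω | ∑ i ∈ s, ξ i ω ≤ z} ≤ 1 := measureReal_le_one
    have a2 : 0 ≤ P.real {ω | ∑ i ∈ s, ξ i ω ≤ z} := measureReal_nonneg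
    have a3 := stdCDF_nonneg z
    have a4 := stdCDF_le_one z
    rw [abs_le]
    constructor <;> linarith
  have h1 : ∀ i, Integrable (ξ i) P := fun i => (h3 i).integrable_of_three
  set W : Ω → ℝ := fun ω => ∑ i ∈ s, ξ i ω with hW
  have hWm : Measurable W := Finset.measurable_sum _ fun j _ => hm j
  have hmW : MeasurableSet {ω | W ω ≤ z} := measurableSet_le hWm measurable_const
  have J1 : Integrable (fun ω => steinDeriv z (W ω)) P :=
    Integrable.of_bound ((measurable_steinDeriv z).comp hWm).aestronglyMeasurable 2
      (Eventually.of_forall fun ω => abs_steinDeriv_le z _)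
  have J3 : ∀ i, Integrable (fun ω => ξ i ω * steinSol z (W ω)) P := fun i =>
    (h1 i).mul_bdd (c := 5) ((continuous_steinSol z).measurable.comp hWm).aestronglyMeasurable
      (Eventually.of_forall fun ω => abs_steinSol_le z _)
  -- Stein's equation at W, with f'(W) distributed over the summands because their variances add up
  -- to one.
  have hpt : ∀ ω, {ω | W ω ≤ z}.indicator (fun _ => (1 : ℝ)) ω - stdCDF z
      = ∑ i ∈ s, ((∫ ω', ξ i ω' ^ 2 ∂P) * steinDeriv z (W ω) - ξ i ω * steinSol z (W ω)) :=
    fun ω => by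
      rw [Finset.sum_sub_distrib, ← Finset.sum_mul, ← Finset.sum_mul, hv]
      simp only [steinDeriv, indicator, mem_ofPred_eq]
      ring
  have hleft : P.real {ω | W ω ≤ z} - stdCDF z
      = ∫ ω, ({ω | W ω ≤ z}.indicator (fun _ => (1 : ℝ)) ω - stdCDF z) ∂P := by
    rw [integral_sub ((integrable_const 1).indicator hmW) (integrable_const _),
      integral_indicator_const _ hmW]
    simp
  rw [hleft]
  simp only [hpt]
  have J4 : ∀ i ∈ s, Integrable (fun ω => (∫ ω', ξ i ω' ^ 2 ∂P) * steinDeriv z (W ω)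
      - ξ i ω * steinSol z (W ω)) P := fun i _ => (J1.const_mul _).sub (J3 i)
  rw [integral_finsetSum s J4]
  calc _ ≤ ∑ i ∈ s, |∫ ω, ((∫ ω', ξ i ω' ^ 2 ∂P) * steinDeriv z (W ω)
        - ξ i ω * steinSol z (W ω)) ∂P| := Finset.abs_sum_le_sum_abs _ _
    _ ≤ ∑ i ∈ s, (46 * (∫ ω, |ξ i ω| ^ 3 ∂P) + 64 * γ * ∫ ω, ξ i ω ^ 2 ∂P) :=
        Finset.sum_le_sum fun i hi => abs_integral_stein_summand_le hI hm h3 h0 hv hγ0 hγ hγ8 z hi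
    _ = 46 * (∑ i ∈ s, ∫ ω, |ξ i ω| ^ 3 ∂P) + 64 * γ := by
        rw [Finset.sum_add_distrib, ← Finset.mul_sum, ← Finset.mul_sum, hv, mul_one]
    _ ≤ 110 * γ := by linarith

end BerryEsseen

/-! ### Coefficients of the truncated partial sums -/

section Window

/-- The coefficient of `ε i` in `∑_{k=1}^n ∑_{j<J} α_j ε_{k-j}`. -/
def windowCoeff (α : ℕ → ℝ) (J n : ℕ) (i : ℤ) : ℝ :=
  ∑ j ∈ Finset.range J, if 1 ≤ i + j ∧ i + j ≤ n then α j else 0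

/-- The indices of the innovations entering the truncated partial sum. -/
def window (J n : ℕ) : Finset ℤ := Finset.Icc (1 - J) n

/-- The sum of the squared coefficients of the truncated partial sum. -/
def windowVar (α : ℕ → ℝ) (J n : ℕ) : ℝ := ∑ i ∈ window J n, windowCoeff α J n i ^ 2

/-- The number of indices counted both by lag `j` and by lag `l`. -/
def overlap (J n j l : ℕ) : ℕ :=
  ((window J n).filter fun i : ℤ => (1 ≤ i + j ∧ i + j ≤ n) ∧ (1 ≤ i + l ∧ i + l ≤ n)).card

/-- The constraints read 1 - min(j, l) ≤ i ≤ n - max(j, l); since j, l < J, the window imposes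
nothing more. -/
lemma overlap_eq {J n j l : ℕ} (hj : j < J) (hl : l < J) :
    overlap J n j l = ((n : ℤ) - max j l + 1 - (1 - min j l)).toNat := by
  rw [overlap, ← Int.card_Icc]
  congr 1
  ext i
  simp only [window, Finset.mem_filter, Finset.mem_Icc]
  omega

lemma overlap_le {J n j l : ℕ} (hj : j < J) (hl : l < J) : overlap J n j l ≤ n := by
  rw [overlap_eq hj hl]; omega

lemma le_overlap_add {J n j l : ℕ} (hj : j < J) (hl : l < J) :
    n ≤ overlap J n j l + (min j n + min l n) := by
  rw [overlap_eq hj hl]; omega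

lemma overlap_zero_left {J n l : ℕ} (hl : l < J) : overlap J n 0 l + min l n = n := by
  rw [overlap_eq (by omega) hl]; omega

/-- Regrouping by the innovation index i = k - j turns the partial sum into a sum of independent
terms. -/
lemma sum_linear_eq_sum_window (α : ℕ → ℝ) (J n : ℕ) (e : ℤ → ℝ) :
    ∑ k ∈ Finset.Icc 1 n, ∑ j ∈ Finset.range J, α j * e ((k : ℤ) - j)
      = ∑ i ∈ window J n, windowCoeff α J n i * e i := by
  simp only [windowCoeff, Finset.sum_mul]
  rw [Finset.sum_comm, Finset.sum_comm (s := window J n)]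
  refine Finset.sum_congr rfl fun j hj => ?_
  rw [Finset.mem_range] at hj
  simp only [ite_mul, zero_mul]
  rw [← Finset.sum_filter]
  refine Finset.sum_nbij' (fun k => (k : ℤ) - j) (fun i => (i + j).toNat) ?_ ?_ ?_ ?_ ?_
  · intro k hk
    simp only [window, Finset.mem_filter, Finset.mem_Icc] at hk ⊢
    omega
  · intro i hi
    simp only [window, Finset.mem_filter, Finset.mem_Icc] at hi ⊢
    omega
  · intro k _
    simp
  · intro i hi
    simp only [window, Finset.mem_filter, Finset.mem_Icc] at hi
    omega
  · intro k _
    rfl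

lemma windowVar_eq (α : ℕ → ℝ) (J n : ℕ) :
    windowVar α J n
      = ∑ j ∈ Finset.range J, ∑ l ∈ Finset.range J, α j * α l * (overlap J n j l : ℝ) := by
  have h : ∀ i, windowCoeff α J n i ^ 2 = ∑ j ∈ Finset.range J, ∑ l ∈ Finset.range J,
      if (1 ≤ i + j ∧ i + j ≤ n) ∧ (1 ≤ i + l ∧ i + l ≤ n) then α j * α l else 0 := fun i => by
    rw [sq, windowCoeff, Finset.sum_mul_sum]
    refine Finset.sum_congr rfl fun j _ => Finset.sum_congr rfl fun l _ => ?_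
    rw [ite_and (1 ≤ i + (j : ℤ) ∧ i + (j : ℤ) ≤ n)]
    split_ifs <;> simp
  simp only [windowVar, h]
  rw [Finset.sum_comm]
  refine Finset.sum_congr rfl fun j _ => ?_
  rw [Finset.sum_comm]
  refine Finset.sum_congr rfl fun l _ => ?_
  rw [← Finset.sum_filter, Finset.sum_const, nsmul_eq_mul, mul_comm]
  rfl

/-- The truncation at lag `J` of `∑_j (j ∧ n) |α_j|`. -/
def truncBias (α : ℕ → ℝ) (J n : ℕ) : ℝ := ∑ j ∈ Finset.range J, min (j : ℝ) n * |α j|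

lemma sub_windowVar_eq (α : ℕ → ℝ) (J n : ℕ) :
    n * (∑ j ∈ Finset.range J, α j) ^ 2 - windowVar α J n
      = ∑ j ∈ Finset.range J, ∑ l ∈ Finset.range J,
          α j * α l * ((n : ℝ) - overlap J n j l) := by
  rw [windowVar_eq, sq, Finset.sum_mul_sum, Finset.mul_sum, ← Finset.sum_sub_distrib]
  refine Finset.sum_congr rfl fun j _ => ?_
  rw [Finset.mul_sum, ← Finset.sum_sub_distrib]
  exact Finset.sum_congr rfl fun l _ => by ring

lemma abs_sub_windowVar_le (α : ℕ → ℝ) (J n : ℕ) :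
    |n * (∑ j ∈ Finset.range J, α j) ^ 2 - windowVar α J n|
      ≤ 2 * (∑ j ∈ Finset.range J, |α j|) * truncBias α J n := by
  rw [sub_windowVar_eq]
  calc _ ≤ ∑ j ∈ Finset.range J, ∑ l ∈ Finset.range J,
        |α j| * |α l| * (min (j : ℝ) n + min (l : ℝ) n) := by
        refine (Finset.abs_sum_le_sum_abs _ _).trans (Finset.sum_le_sum fun j hj => ?_)
        refine (Finset.abs_sum_le_sum_abs _ _).trans (Finset.sum_le_sum fun l hl => ?_)
        rw [Finset.mem_range] at hj hl
        rw [abs_mul, abs_mul]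
        refine mul_le_mul_of_nonneg_left ?_ (by positivity)
        have h1 : (overlap J n j l : ℝ) ≤ n := by exact_mod_cast overlap_le hj hl
        have h2 : (n : ℝ) ≤ overlap J n j l + (min (j : ℝ) n + min (l : ℝ) n) := by
          exact_mod_cast le_overlap_add hj hl
        rw [abs_of_nonneg (by linarith)]
        linarith
    _ = 2 * (∑ j ∈ Finset.range J, |α j|) * truncBias α J n := by
        have e1 : ∑ j ∈ Finset.range J, ∑ l ∈ Finset.range J, |α j| * |α l| * min (j : ℝ) n
            = (∑ j ∈ Finset.range J, |α j|) * truncBias α J n := by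
          rw [Finset.sum_comm, truncBias, Finset.sum_mul_sum]
          exact Finset.sum_congr rfl fun j _ => Finset.sum_congr rfl fun l _ => by ring
        have e2 : ∑ j ∈ Finset.range J, ∑ l ∈ Finset.range J, |α j| * |α l| * min (l : ℝ) n
            = (∑ j ∈ Finset.range J, |α j|) * truncBias α J n := by
          rw [truncBias, Finset.sum_mul_sum]
          exact Finset.sum_congr rfl fun j _ => Finset.sum_congr rfl fun l _ => by ring
        simp only [mul_add, Finset.sum_add_distrib]
        rw [e1, e2]
        ring

/-- For nonnegative coefficients every term of the deficit is nonnegative. The row j = 0 alone is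
kept, where n minus the overlap is exactly min(l, n). -/
lemma le_sub_windowVar {α : ℕ → ℝ} (hα : ∀ j, 0 ≤ α j) {J : ℕ} (hJ : 0 < J) (n : ℕ) :
    α 0 * truncBias α J n ≤ n * (∑ j ∈ Finset.range J, α j) ^ 2 - windowVar α J n := by
  rw [sub_windowVar_eq]
  have hnn : ∀ j ∈ Finset.range J, ∀ l ∈ Finset.range J,
      0 ≤ α j * α l * ((n : ℝ) - overlap J n j l) := fun j hj l hl => by
    have h1 : (overlap J n j l : ℝ) ≤ n := by
      exact_mod_cast overlap_le (Finset.mem_range.1 hj) (Finset.mem_range.1 hl)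
    exact mul_nonneg (mul_nonneg (hα j) (hα l)) (by linarith)
  refine le_trans ?_ (Finset.single_le_sum
    (f := fun j => ∑ l ∈ Finset.range J, α j * α l * ((n : ℝ) - overlap J n j l))
    (fun j hj => Finset.sum_nonneg (hnn j hj)) (Finset.mem_range.2 hJ))
  rw [truncBias, Finset.mul_sum]
  refine Finset.sum_le_sum fun l hl => le_of_eq ?_
  have h : (overlap J n 0 l : ℝ) + min (l : ℝ) n = n := by
    exact_mod_cast overlap_zero_left (Finset.mem_range.1 hl)
  rw [abs_of_nonneg (hα l), ← eq_sub_iff_add_eq'.2 h]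
  ring

lemma abs_windowCoeff_le (α : ℕ → ℝ) (J n : ℕ) (i : ℤ) :
    |windowCoeff α J n i| ≤ ∑ j ∈ Finset.range J, |α j| := by
  refine (Finset.abs_sum_le_sum_abs _ _).trans (Finset.sum_le_sum fun j _ => ?_)
  split_ifs <;> simp

lemma summable_min_mul {α : ℕ → ℝ} (hα : Summable fun j => |α j|) (n : ℕ) :
    Summable fun j : ℕ => min (j : ℝ) n * |α j| :=
  (hα.mul_left (n : ℝ)).of_nonneg_of_le (fun j => by positivity)
    fun j => mul_le_mul_of_nonneg_right (min_le_right _ _) (abs_nonneg _)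

lemma tsum_min_mul {α : ℕ → ℝ} (hα : Summable fun j => |α j|) {n : ℕ} (hn : 1 ≤ n) :
    ∑' j : ℕ, min (j : ℝ) n * |α j| = n * biasTerm α n := by
  have hn0 : (n : ℝ) ≠ 0 := by positivity
  rw [(summable_min_mul hα n).tsum_eq_zero_add, biasTerm, ← mul_assoc, mul_inv_cancel₀ hn0,
    one_mul]
  simp

lemma truncBias_le {α : ℕ → ℝ} (hα : Summable fun j => |α j|) {n : ℕ} (hn : 1 ≤ n) (J : ℕ) :
    truncBias α J n ≤ n * biasTerm α n := by
  rw [← tsum_min_mul hα hn]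
  exact (summable_min_mul hα n).sum_le_tsum _ fun j _ => by positivity

lemma tendsto_truncBias {α : ℕ → ℝ} (hα : Summable fun j => |α j|) {n : ℕ} (hn : 1 ≤ n) :
    Tendsto (fun J => truncBias α J n) atTop (𝓝 (n * biasTerm α n)) := by
  rw [← tsum_min_mul hα hn]
  exact (summable_min_mul hα n).hasSum.tendsto_sum_nat

lemma truncBias_nonneg (α : ℕ → ℝ) (J n : ℕ) : 0 ≤ truncBias α J n :=
  Finset.sum_nonneg fun j _ => by positivity

lemma biasTerm_nonneg (α : ℕ → ℝ) (n : ℕ) : 0 ≤ biasTerm α n :=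
  mul_nonneg (by positivity) (tsum_nonneg fun j => by positivity)

end Window

/-! ### Probabilistic tools -/

section Tools

variable {Ω : Type*} [MeasurableSpace Ω] {P : Measure Ω} [IsProbabilityMeasure P]

/-- Comparison of the distribution functions along an almost surely convergent sequence. -/
lemma eventually_measureReal_le_of_tendsto_ae {S : Ω → ℝ} {T : ℕ → Ω → ℝ}
    (hT : ∀ J, AEStronglyMeasurable (T J) P)
    (hlim : ∀ᵐ ω ∂P, Tendsto (fun J => T J ω) atTop (𝓝 (S ω))) (x : ℝ) {η e : ℝ}
    (hη : 0 < η) (he : 0 < e) :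
    ∀ᶠ J in atTop, P.real {ω | S ω ≤ x} ≤ P.real {ω | T J ω ≤ x + η} + e ∧
      P.real {ω | T J ω ≤ x - η} ≤ P.real {ω | S ω ≤ x} + e := by
  have hmeas := tendstoInMeasure_of_tendsto_ae hT hlim
  rw [tendstoInMeasure_iff_measureReal_dist] at hmeas
  filter_upwards [(hmeas η hη).eventually_lt_const he] with J hJ
  constructor
  · have hsub : {ω | S ω ≤ x} ⊆ {ω | T J ω ≤ x + η} ∪ {ω | η ≤ dist (T J ω) (S ω)} := by
      intro ω (hω : S ω ≤ x)
      by_cases h : T J ω ≤ x + η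
      · exact Or.inl h
      · right
        have : η ≤ T J ω - S ω := by linarith [not_le.1 h]
        exact this.trans (le_abs_self _)
    exact (measureReal_mono hsub).trans ((measureReal_union_le _ _).trans (by linarith))
  · have hsub : {ω | T J ω ≤ x - η} ⊆ {ω | S ω ≤ x} ∪ {ω | η ≤ dist (T J ω) (S ω)} := by
      intro ω (hω : T J ω ≤ x - η)
      by_cases h : S ω ≤ x
      · exact Or.inl h
      · right
        have : η ≤ -(T J ω - S ω) := by linarith [not_le.1 h]
        exact this.trans (neg_le_abs _)
    exact (measureReal_mono hsub).trans ((measureReal_union_le _ _).trans (by linarith))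

/-- The approximation bound is uniform in y, so it may be used at the shifted points x ± η/2;
continuity of G absorbs the shift. -/
lemma abs_measureReal_sub_le_of_tendsto_ae {S : Ω → ℝ} {T : ℕ → Ω → ℝ}
    (hT : ∀ J, AEStronglyMeasurable (T J) P)
    (hlim : ∀ᵐ ω ∂P, Tendsto (fun J => T J ω) atTop (𝓝 (S ω))) {G : ℝ → ℝ} (hG : Continuous G)
    {B : ℝ} (h : ∀ e > 0, ∀ᶠ J in atTop, ∀ y, |P.real {ω | T J ω ≤ y} - G y| ≤ B + e)
    (x : ℝ) : |P.real {ω | S ω ≤ x} - G x| ≤ B := by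
  refine le_of_forall_pos_le_add fun e he => ?_
  obtain ⟨η, hη, hGη⟩ := Metric.continuousAt_iff.1 hG.continuousAt (e / 3) (by positivity)
  obtain ⟨J, hJ1, hJ2⟩ := ((h (e / 3) (by positivity)).and
    (eventually_measureReal_le_of_tendsto_ae hT hlim x (half_pos hη)
      (show 0 < e / 3 by positivity))).exists
  have g1 := abs_lt.1 (hGη (show dist (x + η / 2) x < η by
    simp [abs_of_pos hη]; linarith))
  have g2 := abs_lt.1 (hGη (show dist (x - η / 2) x < η by
    simp [abs_of_pos hη]; linarith))
  have a1 := abs_le.1 (hJ1 (x + η / 2))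
  have a2 := abs_le.1 (hJ1 (x - η / 2))
  rw [abs_le]
  constructor <;> linarith [hJ2.1, hJ2.2, g1.1, g1.2, g2.1, g2.2, a1.1, a1.2, a2.1, a2.2]

/-- As c ≥ 1/2, no point between t and c t is closer to 0 than |t|/2, so the density there is at
most e^{-t²/8}/2; this absorbs the length |c - 1| |t| uniformly in t. -/
lemma abs_stdCDF_mul_sub_le (t : ℝ) {c : ℝ} (hc : 1 / 2 ≤ c) :
    |stdCDF (c * t) - stdCDF t| ≤ |c - 1| := by
  have hexp : |t| ≤ 2 * Real.exp (t ^ 2 / 8) := by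
    have h1 := Real.add_one_le_exp (t ^ 2 / 8)
    have h2 : |t| ≤ 2 * (t ^ 2 / 8 + 1) := by
      rw [← sq_abs]; nlinarith [sq_nonneg (|t| - 2)]
    linarith
  have hb : ∀ u ∈ uIcc t (c * t), stdPDF u ≤ (1 / 2) * Real.exp (-(t ^ 2 / 8)) := by
    intro u hu
    have hu2 : (t / 2) ^ 2 ≤ u ^ 2 := by
      rw [mem_uIcc] at hu
      rcases le_total 0 t with ht | ht
      · have hct : t / 2 ≤ c * t := by nlinarith
        have : t / 2 ≤ u := by rcases hu with hu | hu <;> linarith [hu.1]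
        exact pow_le_pow_left₀ (by linarith) this 2
      · have hct : c * t ≤ t / 2 := by nlinarith
        have : u ≤ t / 2 := by rcases hu with hu | hu <;> linarith [hu.2]
        nlinarith
    rw [stdPDF_eq]
    refine mul_le_mul ?_ (Real.exp_le_exp.2 (by nlinarith)) (Real.exp_pos _).le (by norm_num)
    rw [one_div]
    exact inv_anti₀ (by norm_num) sqrt_two_pi_ge
  have h1 := abs_stdCDF_sub_le hb
  have h2 : |c * t - t| = |c - 1| * |t| := by rw [← abs_mul]; ring_nf
  rw [h2] at h1
  have h3 : Real.exp (-(t ^ 2 / 8)) * Real.exp (t ^ 2 / 8) = 1 := by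
    rw [← Real.exp_add]; simp
  calc _ ≤ _ := h1
    _ ≤ 1 / 2 * Real.exp (-(t ^ 2 / 8)) * (|c - 1| * (2 * Real.exp (t ^ 2 / 8))) := by gcongr
    _ = |c - 1| * (Real.exp (-(t ^ 2 / 8)) * Real.exp (t ^ 2 / 8)) := by ring
    _ = _ := by rw [h3, mul_one]

/-- Changing the variance of a centred normal law. -/
lemma abs_stdCDF_div_sqrt_sub_le {v w : ℝ} (hw : 0 < w) (h1 : w / 2 ≤ v) (h2 : v ≤ 2 * w)
    (y : ℝ) : |stdCDF (y / √v) - stdCDF (y / √w)| ≤ 2 * |v / w - 1| := by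
  have hv : 0 < v := by linarith
  have hsv : 0 < √v := Real.sqrt_pos.2 hv
  have hsw : 0 < √w := Real.sqrt_pos.2 hw
  set c := √w / √v with hc
  have hc0 : 0 < c := div_pos hsw hsv
  have hcsq : c ^ 2 = w / v := by rw [hc, div_pow, Real.sq_sqrt hw.le, Real.sq_sqrt hv.le]
  have hc2 : 1 / 2 ≤ c ^ 2 := by rw [hcsq, le_div_iff₀ hv]; linarith
  have hch : 1 / 2 ≤ c := by nlinarith
  have e1 : y / √v = c * (y / √w) := by rw [hc]; field_simp
  rw [e1]
  refine (abs_stdCDF_mul_sub_le _ hch).trans ?_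
  have h3 : |c - 1| ≤ |c ^ 2 - 1| := by
    have : c ^ 2 - 1 = (c - 1) * (c + 1) := by ring
    rw [this, abs_mul, abs_of_pos (show 0 < c + 1 by linarith)]
    nlinarith [abs_nonneg (c - 1)]
  refine h3.trans ?_
  have e2 : c ^ 2 - 1 = -((v / w - 1) * (w / v)) := by rw [hcsq]; field_simp; ring
  rw [e2, abs_neg, abs_mul, abs_of_pos (show 0 < w / v by positivity), mul_comm]
  refine mul_le_mul_of_nonneg_right ?_ (abs_nonneg _)
  rw [div_le_iff₀ hv]; linarith

end Tools

/-! ### The upper bound -/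

section UpperBound

variable {Ω : Type*} [MeasurableSpace Ω] {P : Measure Ω}

namespace IsInnovationSequence

variable {ε : ℤ → Ω → ℝ}

lemma memLp_three (h : IsInnovationSequence P ε) (i : ℤ) : MemLp (ε i) 3 P := by
  have := h.indep.isProbabilityMeasure
  exact (h.identDistrib i).symm.memLp_snd (memLp_three_of_integrable
    (h.identDistrib 0).aemeasurable_fst.aestronglyMeasurable h.third_moment)

lemma integral_eq_zero (h : IsInnovationSequence P ε) (i : ℤ) : ∫ ω, ε i ω ∂P = 0 :=
  (h.identDistrib i).integral_eq.trans h.mean_eq_zero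

lemma integral_sq (h : IsInnovationSequence P ε) (i : ℤ) : ∫ ω, ε i ω ^ 2 ∂P = 1 :=
  ((h.identDistrib i).comp (u := fun x : ℝ => x ^ 2) (by fun_prop)).integral_eq.trans
    h.second_moment

lemma integral_abs_pow_three (h : IsInnovationSequence P ε) (i : ℤ) :
    ∫ ω, |ε i ω| ^ 3 ∂P = ∫ ω, |ε 0 ω| ^ 3 ∂P :=
  ((h.identDistrib i).comp (u := fun x : ℝ => |x| ^ 3) (by fun_prop)).integral_eq

lemma integral_abs (h : IsInnovationSequence P ε) (i : ℤ) :
    ∫ ω, |ε i ω| ∂P = ∫ ω, |ε 0 ω| ∂P :=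
  ((h.identDistrib i).comp (u := fun x : ℝ => |x|) (by fun_prop)).integral_eq

lemma third_moment_pos (h : IsInnovationSequence P ε) : 0 < ∫ ω, |ε 0 ω| ^ 3 ∂P := by
  have := h.indep.isProbabilityMeasure
  have h1 := integral_sq_le_quarter_add (h.memLp_three 0)
  rw [h.integral_sq] at h1
  linarith

/-- Measurable versions are needed because the estimates for independent sums are proved for
measurable summands. -/
lemma exists_measurable (h : IsInnovationSequence P ε) :
    ∃ ε' : ℤ → Ω → ℝ, IsInnovationSequence P ε' ∧ (∀ i, Measurable (ε' i)) ∧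
      ∀ i, ε i =ᵐ[P] ε' i := by
  have hm : ∀ i, AEMeasurable (ε i) P := fun i => (h.identDistrib i).aemeasurable_fst
  have he : ∀ i, ε i =ᵐ[P] (hm i).mk (ε i) := fun i => (hm i).ae_eq_mk
  refine ⟨fun i => (hm i).mk (ε i), ⟨h.indep.congr he, fun i => ?_, ?_, ?_, ?_⟩,
    fun i => (hm i).measurable_mk, he⟩
  · exact ((IdentDistrib.of_ae_eq (hm i) (he i)).symm.trans (h.identDistrib i)).trans
      (IdentDistrib.of_ae_eq (hm 0) (he 0))
  · rw [← h.mean_eq_zero]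
    exact integral_congr_ae (he 0).symm
  · rw [← h.second_moment]
    refine integral_congr_ae ?_
    filter_upwards [he 0] with ω hω
    rw [hω]
  · refine h.third_moment.congr ?_
    filter_upwards [he 0] with ω hω
    rw [hω]

/-- The series defining a linear process converges absolutely almost surely. -/
lemma ae_summable (h : IsInnovationSequence P ε) {α : ℕ → ℝ} (hα : Summable fun j => |α j|)
    (k : ℤ) : ∀ᵐ ω ∂P, Summable fun j : ℕ => |α j * ε (k - (j : ℤ)) ω| := by
  have := h.indep.isProbabilityMeasure
  have hi : ∀ j : ℕ, MemLp (ε (k - (j : ℤ))) 1 P := fun j =>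
    memLp_one_iff_integrable.2 (h.memLp_three _).integrable_of_three
  refine summable_norm_of_tsum_eLpNorm_ne_top (p := 1) le_rfl
    (f := fun (j : ℕ) ω => α j * ε (k - (j : ℤ)) ω)
    (fun j => ((hi j).const_mul (α j)).aestronglyMeasurable) ?_
  have he : ∀ j : ℕ, eLpNorm (fun ω => α j * ε (k - (j : ℤ)) ω) 1 P
      = ‖α j‖ₑ * eLpNorm (ε 0) 1 P := fun j => by
    rw [← (h.identDistrib (k - (j : ℤ))).eLpNorm_eq]
    exact eLpNorm_const_smul (α j) (ε (k - (j : ℤ))) 1 P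
  simp only [he]
  rw [ENNReal.tsum_mul_right]
  refine ENNReal.mul_ne_top ?_ (memLp_one_iff_integrable.2
    (h.memLp_three 0).integrable_of_three).eLpNorm_ne_top
  exact tsum_enorm_ne_top_iff_summable_norm.2 hα

end IsInnovationSequence

/-- The partial sum of the linear process truncated at lag `J`. -/
def truncSum (α : ℕ → ℝ) (ε : ℤ → Ω → ℝ) (n J : ℕ) (ω : Ω) : ℝ :=
  ∑ i ∈ window J n, windowCoeff α J n i * ε i ω

variable {ε : ℤ → Ω → ℝ}

lemma IsInnovationSequence.ae_tendsto_truncSum (h : IsInnovationSequence P ε) {α : ℕ → ℝ}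
    (hα : Summable fun j => |α j|) (n : ℕ) :
    ∀ᵐ ω ∂P, Tendsto (fun J => truncSum α ε n J ω) atTop (𝓝 (partialSum α ε n ω)) := by
  filter_upwards [ae_all_iff.2 fun k : ℤ => h.ae_summable hα k] with ω hω
  have : (fun J => truncSum α ε n J ω) = fun J =>
      ∑ k ∈ Finset.Icc 1 n, ∑ j ∈ Finset.range J, α j * ε ((k : ℤ) - j) ω := by
    funext J
    exact (sum_linear_eq_sum_window α J n fun i => ε i ω).symm
  rw [this]
  exact tendsto_finsetSum _ fun k _ => (hω k).of_abs.hasSum.tendsto_sum_nat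

lemma measurable_truncSum (hm : ∀ i, Measurable (ε i)) (α : ℕ → ℝ) (n J : ℕ) :
    Measurable (truncSum α ε n J) :=
  Finset.measurable_sum _ fun i _ => (hm i).const_mul _

/-- The Berry–Esseen theorem for weighted sums of innovations. -/
lemma IsInnovationSequence.berry_esseen (h : IsInnovationSequence P ε)
    (hm : ∀ i, Measurable (ε i)) (b : ℤ → ℝ) (s : Finset ℤ) {A : ℝ} (hA : ∀ i, |b i| ≤ A)
    (hv : 0 < ∑ i ∈ s, b i ^ 2) (x : ℝ) :
    |P.real {ω | ∑ i ∈ s, b i * ε i ω ≤ x} - stdCDF (x / √(∑ i ∈ s, b i ^ 2))|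
      ≤ 110 * ((∫ ω, |ε 0 ω| ^ 3 ∂P) * A / √(∑ i ∈ s, b i ^ 2)) := by
  have := h.indep.isProbabilityMeasure
  set v := ∑ i ∈ s, b i ^ 2 with hvdef
  set β := ∫ ω, |ε 0 ω| ^ 3 ∂P with hβ
  have hβ0 : 0 < β := h.third_moment_pos
  have hsv : 0 < √v := Real.sqrt_pos.2 hv
  have hsq : √v ^ 2 = v := Real.sq_sqrt hv.le
  have hA0 : 0 < A := by
    refine lt_of_le_of_ne ((abs_nonneg _).trans (hA 0)) fun h0 => hv.ne' ?_
    refine Finset.sum_eq_zero fun i _ => ?_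
    have := abs_nonpos_iff.1 ((hA i).trans_eq h0.symm)
    simp [this]
  -- After normalisation by √v, the sum of third moments is at most β A/√v, since Σ|b_i|³ ≤ A Σ
  -- b_i².
  have key := berry_esseen_of_sum_variance_eq_one (P := P)
    (ξ := fun i ω => b i / √v * ε i ω)
    (h.indep.comp (fun i x => b i / √v * x) (fun i => by fun_prop))
    (fun i => (hm i).const_mul _) (fun i => (h.memLp_three i).const_mul _)
    (fun i => by rw [integral_const_mul, h.integral_eq_zero, mul_zero]) s
    (by
      simp only [mul_pow, integral_const_mul, h.integral_sq, mul_one, div_pow, hsq]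
      rw [← Finset.sum_div, ← hvdef, div_self hv.ne'])
    (γ := β * A / √v) (by positivity)
    (by
      simp only [abs_mul, mul_pow, integral_const_mul, h.integral_abs_pow_three, ← hβ, abs_div,
        abs_of_pos hsv, div_pow]
      rw [← Finset.sum_mul, ← Finset.sum_div]
      have h1 : ∑ i ∈ s, |b i| ^ 3 ≤ A * v := by
        rw [hvdef, Finset.mul_sum]
        refine Finset.sum_le_sum fun i _ => ?_
        rw [pow_succ, sq_abs, mul_comm]
        exact mul_le_mul_of_nonneg_right (hA i) (sq_nonneg _)
      calc (∑ i ∈ s, |b i| ^ 3) / √v ^ 3 * β ≤ A * v / √v ^ 3 * β := by gcongr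
        _ = A * √v ^ 2 / √v ^ 3 * β := by rw [hsq]
        _ = β * A / √v := by field_simp) (x / √v)
  have hset : {ω | ∑ i ∈ s, b i / √v * ε i ω ≤ x / √v} = {ω | ∑ i ∈ s, b i * ε i ω ≤ x} := by
    ext ω
    change ∑ i ∈ s, b i / √v * ε i ω ≤ x / √v ↔ ∑ i ∈ s, b i * ε i ω ≤ x
    rw [le_div_iff₀ hsv, Finset.sum_mul]
    refine iff_of_eq (congrArg (· ≤ x) (Finset.sum_congr rfl fun i _ => ?_))
    field_simp
  rwa [hset] at key

lemma bddAbove_normalDistance [IsProbabilityMeasure P] (α : ℕ → ℝ) (ε : ℤ → Ω → ℝ) (n : ℕ) :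
    BddAbove (range fun x : ℝ =>
      |P.real {ω | partialSum α ε n ω ≤ x * √((n : ℝ) * longRunStd α ^ 2)}
        - cdf (gaussianReal 0 1) x|) := by
  refine ⟨1, ?_⟩
  rintro _ ⟨x, rfl⟩
  have a1 : P.real {ω | partialSum α ε n ω ≤ x * √((n : ℝ) * longRunStd α ^ 2)} ≤ 1 :=
    measureReal_le_one
  have a2 : 0 ≤ P.real {ω | partialSum α ε n ω ≤ x * √((n : ℝ) * longRunStd α ^ 2)} :=
    measureReal_nonneg
  have a3 := stdCDF_nonneg x
  have a4 := stdCDF_le_one x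
  rw [stdCDF] at a3 a4
  exact abs_le.2 ⟨by linarith, by linarith⟩

lemma normalDistance_le_one [IsProbabilityMeasure P] (α : ℕ → ℝ) (ε : ℤ → Ω → ℝ) (n : ℕ) :
    normalDistance P α ε n ≤ 1 := by
  refine ciSup_le fun x => ?_
  have a1 : P.real {ω | partialSum α ε n ω ≤ x * √((n : ℝ) * longRunStd α ^ 2)} ≤ 1 :=
    measureReal_le_one
  have a2 : 0 ≤ P.real {ω | partialSum α ε n ω ≤ x * √((n : ℝ) * longRunStd α ^ 2)} :=
    measureReal_nonneg
  have a3 := stdCDF_nonneg x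
  have a4 := stdCDF_le_one x
  rw [stdCDF] at a3 a4
  exact abs_le.2 ⟨by linarith, by linarith⟩

lemma normalDistance_congr {ε' : ℤ → Ω → ℝ} (h : ∀ i, ε i =ᵐ[P] ε' i) (α : ℕ → ℝ) (n : ℕ) :
    normalDistance P α ε n = normalDistance P α ε' n := by
  have hall : ∀ᵐ ω ∂P, ∀ i, ε i ω = ε' i ω := ae_all_iff.2 h
  unfold normalDistance
  congr 1
  funext x
  congr 2
  refine measureReal_congr (eventuallyEq_set.2 ?_)
  filter_upwards [hall] with ω hω
  have : partialSum α ε n ω = partialSum α ε' n ω := by simp [partialSum, linearProcess, hω]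
  change _ ≤ _ ↔ _ ≤ _
  rw [this]

lemma rate_eq (α : ℕ → ℝ) (n : ℕ) : rate α n = 1 / √(n : ℝ) + biasTerm α n := by
  rw [rate, Real.rpow_neg (by positivity), ← Real.sqrt_eq_rpow, one_div]

lemma IsInnovationSequence.normalDistance_le_of_measurable (h : IsInnovationSequence P ε)
    (hm : ∀ i, Measurable (ε i)) {α : ℕ → ℝ} (hα : IsAdmissibleCoeff α) {n : ℕ} (hn : 1 ≤ n) :
    normalDistance P α ε n
      ≤ (220 * (∫ ω, |ε 0 ω| ^ 3 ∂P) * (∑' j, |α j|) / longRunStd α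
        + 8 * (∑' j, |α j|) / longRunStd α ^ 2) * rate α n := by
  have := h.indep.isProbabilityMeasure
  set β := ∫ ω, |ε 0 ω| ^ 3 ∂P with hβ
  set A := ∑' j, |α j| with hA
  set s := longRunStd α with hs
  set R := biasTerm α n with hR
  have hβ0 : 0 < β := h.third_moment_pos
  have hs0 : 0 < s := abs_pos.2 hα.tsum_ne_zero
  have hA0 : 0 ≤ A := tsum_nonneg fun j => abs_nonneg _
  have hR0 : 0 ≤ R := biasTerm_nonneg α n
  have hn0 : (0 : ℝ) < n := by positivity
  have hsn : 0 < √(n : ℝ) := Real.sqrt_pos.2 hn0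
  rw [rate_eq, ← hR]
  -- If the bias is large, the term 8AR/s² of the bound is at least 1. Otherwise 2AR/s² ≤ 1/4, which
  -- keeps the truncated variances comparable to n s².
  rcases le_or_gt (s ^ 2) (8 * A * R) with hcase | hcase
  · refine (normalDistance_le_one α ε n).trans ?_
    have h1 : 1 ≤ 8 * A / s ^ 2 * R := by
      rw [div_mul_eq_mul_div, le_div_iff₀ (by positivity)]; linarith
    have h2 : 0 ≤ 220 * β * A / s := by positivity
    have h3 : 0 ≤ 8 * A / s ^ 2 := by positivity
    have h4 : 0 ≤ 1 / √(n : ℝ) := by positivity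
    nlinarith [mul_nonneg h2 h4, mul_nonneg h2 hR0, mul_nonneg h3 h4]
  set w : ℝ := n * s ^ 2 with hw
  have hw0 : 0 < w := by positivity
  have hsw : √w = √(n : ℝ) * s := by rw [hw, Real.sqrt_mul hn0.le, Real.sqrt_sq hs0.le]
  set B := 220 * β * A / s * (1 / √(n : ℝ)) + 4 * A / s ^ 2 * R with hB
  have hlimJ : Tendsto (fun J => (∑ j ∈ Finset.range J, α j) ^ 2) atTop (𝓝 (s ^ 2)) := by
    have h1 := (hα.summable_abs.of_abs.hasSum.tendsto_sum_nat).pow 2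
    rwa [hs, longRunStd, sq_abs]
  have hevent : ∀ e > 0, ∀ᶠ J in atTop, ∀ y,
      |P.real {ω | truncSum α ε n J ω ≤ y} - stdCDF (y / √w)| ≤ B + e := by
    intro e he
    -- The e/2 becomes e after the factor 2 in `abs_stdCDF_div_sqrt_sub_le`; the 1/4, together with
    -- 2AR/s² ≤ 1/4, keeps v/w within 1/2 of 1.
    have hδ : 0 < s ^ 2 * min (e / 2) (1 / 4) := by positivity
    filter_upwards [Metric.tendsto_nhds.1 hlimJ _ hδ] with J hJ y
    rw [Real.dist_eq] at hJ
    set aJ := ∑ j ∈ Finset.range J, α j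
    set AJ := ∑ j ∈ Finset.range J, |α j| with hAJ
    set v := windowVar α J n with hv
    have hAJ0 : 0 ≤ AJ := Finset.sum_nonneg fun j _ => abs_nonneg _
    have hAJle : AJ ≤ A := hα.summable_abs.sum_le_tsum _ fun j _ => abs_nonneg _
    have hv1 : |n * aJ ^ 2 - v| ≤ 2 * A * (n * R) := by
      refine (abs_sub_windowVar_le α J n).trans ?_
      have := truncBias_le hα.summable_abs hn J
      have := truncBias_nonneg α J n
      gcongr
    have hvw : |v / w - 1| ≤ min (e / 2) (1 / 4) + 2 * A * R / s ^ 2 := by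
      have e1 : v / w - 1 = (n * (aJ ^ 2 - s ^ 2) - (n * aJ ^ 2 - v)) / w := by
        rw [hw]; field_simp; ring
      have h2 := abs_sub (n * (aJ ^ 2 - s ^ 2)) (n * aJ ^ 2 - v)
      rw [abs_mul, abs_of_pos hn0] at h2
      rw [e1, abs_div, abs_of_pos hw0, div_le_iff₀ hw0]
      calc _ ≤ n * |aJ ^ 2 - s ^ 2| + |n * aJ ^ 2 - v| := h2
        _ ≤ n * (s ^ 2 * min (e / 2) (1 / 4)) + 2 * A * (n * R) := by
            gcongr
        _ = _ := by rw [hw]; field_simp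
    have hAR : 2 * A * R / s ^ 2 ≤ 1 / 4 := by
      rw [div_le_iff₀ (by positivity)]; linarith
    have hvw2 : |v / w - 1| ≤ 1 / 2 := by
      linarith [min_le_right (e / 2) (1 / 4 : ℝ)]
    have hvw3 := abs_le.1 hvw2
    have hlow : w / 2 ≤ v := by
      have : 1 / 2 ≤ v / w := by linarith [hvw3.1]
      rw [le_div_iff₀ hw0] at this; linarith
    have hup : v ≤ 2 * w := by
      have : v / w ≤ 2 := by linarith [hvw3.2]
      rwa [div_le_iff₀ hw0] at this
    have hv0 : 0 < v := by linarith
    have hbe := h.berry_esseen hm (windowCoeff α J n) (window J n) (A := A)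
      (fun i => (abs_windowCoeff_le α J n i).trans hAJle) hv0 y
    have hgauss := abs_stdCDF_div_sqrt_sub_le hw0 hlow hup y
    have hsqv : √(n : ℝ) * s / 2 ≤ √v := by
      rw [← hsw]
      apply Real.le_sqrt_of_sq_le
      rw [div_pow, Real.sq_sqrt hw0.le]
      linarith
    have hbe2 : 110 * (β * A / √v) ≤ 220 * β * A / s * (1 / √(n : ℝ)) := by
      calc 110 * (β * A / √v) ≤ 110 * (β * A / (√(n : ℝ) * s / 2)) := by gcongr
        _ = _ := by field_simp; ring
    have htri := abs_sub_le (P.real {ω | truncSum α ε n J ω ≤ y}) (stdCDF (y / √v))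
      (stdCDF (y / √w))
    have hmin := min_le_left (e / 2) (1 / 4 : ℝ)
    have hfin : 2 * (2 * A * R / s ^ 2) = 4 * A / s ^ 2 * R := by ring
    have hbe3 : |P.real {ω | truncSum α ε n J ω ≤ y} - stdCDF (y / √v)|
        ≤ 110 * (β * A / √v) := hbe
    rw [hB]
    linarith
  have hbound := abs_measureReal_sub_le_of_tendsto_ae
    (fun J => (measurable_truncSum hm α n J).aestronglyMeasurable)
    (h.ae_tendsto_truncSum hα.summable_abs n)
    (continuous_stdCDF.comp (continuous_id.div_const √w)) hevent
  refine ciSup_le fun x => ?_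
  have hx := hbound (x * √w)
  simp only [Function.comp, id, mul_div_cancel_right₀ x (Real.sqrt_pos.2 hw0).ne'] at hx
  refine hx.trans ?_
  have h2 : 0 ≤ 220 * β * A / s := by positivity
  have h3 : 0 ≤ 4 * A / s ^ 2 := by positivity
  have h4 : 0 ≤ 1 / √(n : ℝ) := by positivity
  have h5 : 8 * A / s ^ 2 = 2 * (4 * A / s ^ 2) := by ring
  rw [hB, h5]
  nlinarith [mul_nonneg h2 h4, mul_nonneg h2 hR0, mul_nonneg h3 h4, mul_nonneg h3 hR0]

theorem IsInnovationSequence.normalDistance_le (h : IsInnovationSequence P ε) {α : ℕ → ℝ}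
    (hα : IsAdmissibleCoeff α) {n : ℕ} (hn : 1 ≤ n) :
    normalDistance P α ε n
      ≤ (220 * (∫ ω, |ε 0 ω| ^ 3 ∂P) * (∑' j, |α j|) / longRunStd α
        + 8 * (∑' j, |α j|) / longRunStd α ^ 2) * rate α n := by
  obtain ⟨ε', h', hm, he⟩ := h.exists_measurable
  have hβ : ∫ ω, |ε 0 ω| ^ 3 ∂P = ∫ ω, |ε' 0 ω| ^ 3 ∂P := by
    refine integral_congr_ae ?_
    filter_upwards [he 0] with ω hω
    rw [hω]
  rw [normalDistance_congr he, hβ]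
  exact h'.normalDistance_le_of_measurable hm hα hn

end UpperBound

/-! ### Sharpness -/

section Sharpness

/-- Independent copies of a standardised law form an innovation sequence. -/
lemma isInnovationSequence_infinitePi (μ : Measure ℝ) [IsProbabilityMeasure μ]
    (h1 : ∫ x, x ∂μ = 0) (h2 : ∫ x, x ^ 2 ∂μ = 1) (h3 : Integrable (fun x => |x| ^ 3) μ) :
    IsInnovationSequence (Measure.infinitePi fun _ : ℤ => μ) (fun i ω => ω i) := by
  have hp : ∀ i : ℤ, MeasurePreserving (fun ω : ℤ → ℝ => ω i)
      (Measure.infinitePi fun _ : ℤ => μ) μ := fun i =>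
    measurePreserving_eval_infinitePi (fun _ : ℤ => μ) i
  refine ⟨iIndepFun_infinitePi (P := fun _ : ℤ => μ) (X := fun _ x => x)
    fun _ => measurable_id, fun i => ⟨(hp i).aemeasurable, (hp 0).aemeasurable, ?_⟩, ?_, ?_, ?_⟩
  · rw [(hp i).map_eq, (hp 0).map_eq]
  · rw [← integral_map (f := fun x : ℝ => x) (hp 0).aemeasurable (by fun_prop), (hp 0).map_eq, h1]
  · rw [← integral_map (f := fun x : ℝ => x ^ 2) (hp 0).aemeasurable (by fun_prop),
      (hp 0).map_eq, h2]
  · exact (hp 0).integrable_comp_of_integrable h3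

lemma le_normalDistance {Ω : Type*} [MeasurableSpace Ω] {P : Measure Ω} [IsProbabilityMeasure P]
    (α : ℕ → ℝ) (ε : ℤ → Ω → ℝ) (n : ℕ) (x : ℝ) :
    |P.real {ω | partialSum α ε n ω ≤ x * √((n : ℝ) * longRunStd α ^ 2)} - stdCDF x|
      ≤ normalDistance P α ε n :=
  le_ciSup (bddAbove_normalDistance α ε n) x

lemma stdPDF_le_stdPDF {t u : ℝ} (h : |t| ≤ |u|) : stdPDF u ≤ stdPDF t := by
  rw [stdPDF_eq, stdPDF_eq]
  refine mul_le_mul_of_nonneg_left (Real.exp_le_exp.2 ?_) (by positivity)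
  have := sq_le_sq.2 h
  linarith

/-! #### Integer valued innovations -/

/-- The Rademacher law. -/
def rademacher : Measure ℝ :=
  (1 / 2 : ENNReal) • Measure.dirac 1 + (1 / 2 : ENNReal) • Measure.dirac (-1)

instance : IsProbabilityMeasure rademacher := ⟨by
  simp [rademacher, ENNReal.inv_two_add_inv_two]⟩

lemma integrable_rademacher (f : ℝ → ℝ) : Integrable f rademacher := by
  have h : ∀ a : ℝ, Integrable f (Measure.dirac a) := fun a => integrable_dirac (by simp)
  exact ((h 1).smul_measure (by simp)).add_measure ((h (-1)).smul_measure (by simp))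

lemma integral_rademacher (f : ℝ → ℝ) : ∫ x, f x ∂rademacher = (f 1 + f (-1)) / 2 := by
  have h : ∀ a : ℝ, Integrable f (Measure.dirac a) := fun a => integrable_dirac (by simp)
  rw [rademacher, integral_add_measure ((h 1).smul_measure (by simp))
    ((h (-1)).smul_measure (by simp)), integral_smul_measure, integral_smul_measure,
    integral_dirac, integral_dirac]
  simp
  ring

lemma ae_rademacher : ∀ᵐ x ∂rademacher, x = 1 ∨ x = -1 := by
  rw [rademacher, ae_add_measure_iff]
  constructor <;> refine Measure.ae_smul_measure ?_ _ <;> rw [ae_dirac_eq] <;> simp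

/-- If the partial sums are integer valued, the distance to the normal law is at least of order
`n^{-1/2}`. -/
lemma inv_sqrt_le_normalDistance {Ω : Type*} [MeasurableSpace Ω] {P : Measure Ω}
    [IsProbabilityMeasure P] {α : ℕ → ℝ} {ε : ℤ → Ω → ℝ} {n : ℕ} (hn : 1 ≤ n)
    (hs : longRunStd α = 1) (hint : ∀ᵐ ω ∂P, ∃ m : ℤ, partialSum α ε n ω = m) :
    1 / 20 * (1 / √(n : ℝ)) ≤ normalDistance P α ε n := by
  have hn1 : (1 : ℝ) ≤ √(n : ℝ) := Real.one_le_sqrt.2 (by exact_mod_cast hn)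
  have hsn : 0 < √(n : ℝ) := by linarith
  have h0 := le_normalDistance (P := P) α ε n 0
  -- This point corresponds to S_n ≤ 1/2, the same event as S_n ≤ 0. As Φ grows by at least
  -- (1/5)/(2√n) from 0 to it, one of the two errors is at least half of that.
  have h1 := le_normalDistance (P := P) α ε n (1 / (2 * √(n : ℝ)))
  have e1 : 1 / (2 * √(n : ℝ)) * √((n : ℝ) * longRunStd α ^ 2) = 1 / 2 := by
    rw [hs, one_pow, mul_one]; field_simp
  rw [e1] at h1
  rw [zero_mul] at h0
  have e2 : P.real {ω | partialSum α ε n ω ≤ 1 / 2} = P.real {ω | partialSum α ε n ω ≤ 0} := by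
    refine measureReal_congr (eventuallyEq_set.2 ?_)
    filter_upwards [hint] with ω ⟨m, hm⟩
    change partialSum α ε n ω ≤ 1 / 2 ↔ partialSum α ε n ω ≤ 0
    rw [hm]
    constructor
    · intro h
      have : (m : ℝ) < 1 := by linarith
      have h2 : m < 1 := by exact_mod_cast this
      have h3 : m ≤ 0 := by omega
      exact_mod_cast h3
    · intro h; linarith
  rw [e2] at h1
  have hle : 1 / (2 * √(n : ℝ)) ≤ 1 := by
    rw [div_le_one (by positivity)]; linarith
  have h2 := stdCDF_sub_ge (x := 0) (y := 1 / (2 * √(n : ℝ))) (m := 1 / 5) (by positivity)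
    (fun t ht => stdPDF_ge (abs_le.2 ⟨by linarith [ht.1], ht.2.trans hle⟩))
  have e3 : 1 / 20 * (1 / √(n : ℝ)) = 1 / 5 * (1 / (2 * √(n : ℝ)) - 0) / 2 := by
    field_simp; norm_num
  rw [e3]
  linarith [(abs_le.1 h0).1, (abs_le.1 h0).2, (abs_le.1 h1).1, (abs_le.1 h1).2]

/-- The coefficients of the process `X_k = ε_k`. -/
def unitCoeff (j : ℕ) : ℝ := if j = 0 then 1 else 0

lemma tsum_unitCoeff : ∑' j, unitCoeff j = 1 := by simp [unitCoeff, tsum_ite_eq]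

lemma isAdmissibleCoeff_unitCoeff : IsAdmissibleCoeff unitCoeff := by
  refine ⟨summable_of_ne_finset_zero (s := {0}) fun j hj => ?_, ?_⟩
  · have : j ≠ 0 := by simpa using hj
    simp [unitCoeff, this]
  · rw [tsum_unitCoeff]; exact one_ne_zero

lemma biasTerm_unitCoeff (n : ℕ) : biasTerm unitCoeff n = 0 := by simp [biasTerm, unitCoeff]

lemma linearProcess_unitCoeff {Ω : Type*} (ε : ℤ → Ω → ℝ) (k : ℤ) (ω : Ω) :
    linearProcess unitCoeff ε k ω = ε k ω := by
  rw [linearProcess, tsum_eq_single 0 fun j hj => by simp [unitCoeff, hj]]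
  simp [unitCoeff]

theorem attainsRate_rademacher :
    AttainsRate (Measure.infinitePi fun _ : ℤ => rademacher) unitCoeff (fun i ω => ω i) := by
  refine ⟨1 / 20, by norm_num, fun n hn => ?_⟩
  rw [rate_eq, biasTerm_unitCoeff, add_zero]
  refine inv_sqrt_le_normalDistance hn (by rw [longRunStd, tsum_unitCoeff, abs_one]) ?_
  have hall : ∀ᵐ ω ∂(Measure.infinitePi fun _ : ℤ => rademacher), ∀ i : ℤ, ω i = 1 ∨ ω i = -1 :=
    ae_all_iff.2 fun i => (measurePreserving_eval_infinitePi
      (fun _ : ℤ => rademacher) i).quasiMeasurePreserving.ae ae_rademacher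
  filter_upwards [hall] with ω hω
  refine ⟨∑ k ∈ Finset.Icc 1 n, if ω (k : ℤ) = 1 then 1 else -1, ?_⟩
  rw [partialSum, Int.cast_sum]
  refine Finset.sum_congr rfl fun k _ => ?_
  rw [linearProcess_unitCoeff]
  rcases hω k with h | h <;> rw [h] <;> norm_num

/-! #### Gaussian innovations -/

section Gaussian

variable {Ω : Type*} [MeasurableSpace Ω] {P : Measure Ω} {ε : ℤ → Ω → ℝ}

lemma map_sum_gaussian [IsProbabilityMeasure P] (hI : iIndepFun ε P)
    (hm : ∀ i, Measurable (ε i)) (hg : ∀ i, P.map (ε i) = gaussianReal 0 1) (b : ℤ → ℝ)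
    (s : Finset ℤ) :
    P.map (fun ω => ∑ i ∈ s, b i * ε i ω)
      = gaussianReal 0 (∑ i ∈ s, NNReal.mk (b i ^ 2) (sq_nonneg _)) := by
  have hI' : iIndepFun (fun i ω => b i * ε i ω) P :=
    hI.comp (fun i x => b i * x) (fun i => by fun_prop)
  have hm' : ∀ i, Measurable fun ω => b i * ε i ω := fun i => (hm i).const_mul _
  induction s using Finset.induction_on with
  | empty => simp
  | insert a s ha ih =>
    have h1 : P.map (fun ω => b a * ε a ω) = gaussianReal 0 (NNReal.mk (b a ^ 2) (sq_nonneg _)) := by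
      have := Measure.map_map (μ := P) (g := fun x => b a * x) (by fun_prop) (hm a)
      rw [hg a, gaussianReal_map_const_mul, mul_zero, mul_one] at this
      exact this.symm
    have hind : IndepFun (fun ω => b a * ε a ω) (fun ω => ∑ i ∈ s, b i * ε i ω) P := by
      have := hI'.indepFun_sum_erase hm' s a
      rwa [Finset.erase_eq_of_notMem ha] at this
    have h2 := gaussianReal_add_gaussianReal_of_indepFun hind h1 ih
    rw [Finset.sum_insert ha, ← add_zero (0 : ℝ), ← h2]
    congr 1
    funext ω
    simp [Finset.sum_insert ha]

lemma gaussianReal_real_Iic {v : NNReal} (hv : v ≠ 0) (y : ℝ) :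
    (gaussianReal 0 v).real (Iic y) = stdCDF (y / √v) := by
  have hsv : 0 < √(v : ℝ) := Real.sqrt_pos.2 (by positivity)
  have h := gaussianReal_map_const_mul (μ := 0) (v := 1) √(v : ℝ)
  have h2 : NNReal.mk (√(v : ℝ) ^ 2) (sq_nonneg _) * 1 = v := by
    rw [mul_one]; ext; simp
  rw [mul_zero, h2] at h
  rw [← h, map_measureReal_apply (by fun_prop) measurableSet_Iic, stdCDF, cdf_eq_real]
  congr 1
  ext x
  change √(v : ℝ) * x ≤ y ↔ x ≤ y / √(v : ℝ)
  rw [le_div_iff₀ hsv, mul_comm]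

lemma measureReal_truncSum_le [IsProbabilityMeasure P] (hI : iIndepFun ε P)
    (hm : ∀ i, Measurable (ε i)) (hg : ∀ i, P.map (ε i) = gaussianReal 0 1) (α : ℕ → ℝ)
    (n J : ℕ) (hv : 0 < windowVar α J n) (y : ℝ) :
    P.real {ω | truncSum α ε n J ω ≤ y} = stdCDF (y / √(windowVar α J n)) := by
  set v : NNReal := ∑ i ∈ window J n, NNReal.mk (windowCoeff α J n i ^ 2) (sq_nonneg _) with hvdef
  have hcoe : (v : ℝ) = windowVar α J n := by
    rw [hvdef, NNReal.coe_sum]; rfl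
  have h := map_sum_gaussian hI hm hg (windowCoeff α J n) (window J n)
  have hv0 : v ≠ 0 := fun h0 => by rw [h0] at hcoe; simp at hcoe; linarith
  rw [← hcoe, ← gaussianReal_real_Iic hv0, hvdef, ← h,
    map_measureReal_apply (f := fun ω => ∑ i ∈ window J n, windowCoeff α J n i * ε i ω)
      (measurable_truncSum hm α n J) measurableSet_Iic]
  rfl

lemma windowVar_pos {α : ℕ → ℝ} (hα : ∀ j, 0 ≤ α j) (h0 : 0 < α 0) {J n : ℕ} (hJ : 0 < J)
    (hn : 1 ≤ n) : 0 < windowVar α J n := by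
  rw [windowVar_eq]
  have hnn : ∀ j l, 0 ≤ α j * α l * (overlap J n j l : ℝ) := fun j l =>
    mul_nonneg (mul_nonneg (hα j) (hα l)) (Nat.cast_nonneg _)
  have hov : overlap J n 0 0 = n := by simpa using overlap_zero_left (J := J) (n := n) hJ
  have hmem := Finset.mem_range.2 hJ
  calc 0 < α 0 * α 0 * (overlap J n 0 0 : ℝ) := by rw [hov]; positivity
    _ ≤ ∑ l ∈ Finset.range J, α 0 * α l * (overlap J n 0 l : ℝ) :=
        Finset.single_le_sum (f := fun l => α 0 * α l * (overlap J n 0 l : ℝ))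
          (fun l _ => hnn 0 l) hmem
    _ ≤ _ := Finset.single_le_sum
        (f := fun j => ∑ l ∈ Finset.range J, α j * α l * (overlap J n j l : ℝ))
        (fun j _ => Finset.sum_nonneg fun l _ => hnn j l) hmem

lemma biasTerm_le_tsum {α : ℕ → ℝ} (hα : ∀ j, 0 ≤ α j) (hs : Summable α) {n : ℕ} (hn : 1 ≤ n) :
    biasTerm α n ≤ ∑' j, α (j + 1) := by
  have hn0 : (0 : ℝ) < n := by positivity
  have hs1 : Summable fun j => α (j + 1) := (summable_nat_add_iff 1).2 hs
  have hle : ∀ j : ℕ, min ((j : ℝ) + 1) n * |α (j + 1)| ≤ n * α (j + 1) := fun j => by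
    rw [abs_of_nonneg (hα _)]
    exact mul_le_mul_of_nonneg_right (min_le_right _ _) (hα _)
  have hs2 : Summable fun j : ℕ => min ((j : ℝ) + 1) n * |α (j + 1)| :=
    (hs1.mul_left (n : ℝ)).of_nonneg_of_le (fun j => by positivity) hle
  rw [biasTerm, inv_mul_le_iff₀ hn0, ← tsum_mul_left]
  exact hs2.tsum_le_tsum hle (hs1.mul_left _)

/-- For Gaussian innovations and non-negative coefficients the distance to the normal law is at
least of the order of the bias term. -/
lemma biasTerm_le_normalDistance_of_gaussian (h : IsInnovationSequence P ε)
    (hm : ∀ i, Measurable (ε i)) (hg : ∀ i, P.map (ε i) = gaussianReal 0 1) {α : ℕ → ℝ}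
    (hα : ∀ j, 0 ≤ α j) (h0 : α 0 = 1) (hsum : Summable α) {n : ℕ} (hn : 1 ≤ n) :
    stdPDF 2 / (2 * longRunStd α ^ 2) * biasTerm α n ≤ normalDistance P α ε n := by
  have := h.indep.isProbabilityMeasure
  have habs : Summable fun j => |α j| := hsum.abs
  set s := longRunStd α with hsdef
  have hs : s = ∑' j, α j := abs_of_nonneg (tsum_nonneg hα)
  set R := biasTerm α n with hR
  have hR0 : 0 ≤ R := biasTerm_nonneg α n
  have hR1 : R ≤ s - 1 := by
    have h1 := biasTerm_le_tsum hα hsum hn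
    have h2 := hsum.tsum_eq_zero_add
    rw [h0] at h2
    linarith
  have hs1 : 1 ≤ s := by linarith
  have hn0 : (0 : ℝ) < n := by positivity
  set w : ℝ := n * s ^ 2 with hw
  -- The limit of upper bounds for the truncated variances, as α 0 = 1. Since R ≤ s - 1 < s², it is
  -- positive.
  set K : ℝ := n * s ^ 2 - n * R with hK
  have hw0 : 0 < w := by positivity
  have hK0 : 0 < K := by
    have : 0 < s ^ 2 - R := by nlinarith
    rw [hK, ← mul_sub]; positivity
  set q := P.real {ω | partialSum α ε n ω ≤ √w} with hq
  set KJ : ℕ → ℝ := fun J => n * (∑ j ∈ Finset.range J, α j) ^ 2 - truncBias α J n with hKJ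
  have hKlim : Tendsto KJ atTop (𝓝 K) := by
    have h1 := ((hsum.hasSum.tendsto_sum_nat.pow 2).const_mul (n : ℝ)).sub
      (tendsto_truncBias habs hn)
    rwa [← hs] at h1
  have hsw : 0 < √w := Real.sqrt_pos.2 hw0
  -- the distribution function of the limit dominates that of the normal law with variance `K`
  have hstep : ∀ η, 0 < η → η < √w → stdCDF ((√w - η) / √K) ≤ q := by
    intro η hη hηw
    refine le_of_forall_pos_le_add fun e he => ?_
    have hlim : Tendsto (fun J => stdCDF ((√w - η) / √(KJ J))) atTop
        (𝓝 (stdCDF ((√w - η) / √K))) :=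
      (continuous_stdCDF.tendsto _).comp (tendsto_const_nhds.div
        ((Real.continuous_sqrt.tendsto _).comp hKlim) (Real.sqrt_pos.2 hK0).ne')
    refine le_of_tendsto hlim ?_
    filter_upwards [eventually_measureReal_le_of_tendsto_ae
      (fun J => (measurable_truncSum hm α n J).aestronglyMeasurable)
      (h.ae_tendsto_truncSum habs n) √w hη he, eventually_gt_atTop 0] with J hJ hJ0
    have hv0 : 0 < windowVar α J n := windowVar_pos hα (by rw [h0]; norm_num) hJ0 hn
    have h2 := hJ.2
    rw [measureReal_truncSum_le h.indep hm hg α n J hv0] at h2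
    refine le_trans (monotone_stdCDF ?_) h2
    have hvK : windowVar α J n ≤ KJ J := by
      have := le_sub_windowVar hα hJ0 n
      rw [h0, one_mul] at this
      simp only [hKJ]
      linarith
    exact div_le_div_of_nonneg_left (by linarith) (Real.sqrt_pos.2 hv0) (Real.sqrt_le_sqrt hvK)
  have hqge : stdCDF (√w / √K) ≤ q := by
    have hlim : Tendsto (fun η => stdCDF ((√w - η) / √K)) (𝓝[>] 0)
        (𝓝 (stdCDF (√w / √K))) := by
      have hc : Continuous fun η => stdCDF ((√w - η) / √K) :=
        continuous_stdCDF.comp ((continuous_const.sub continuous_id).div_const _)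
      have := (hc.tendsto 0).mono_left (nhdsWithin_le_nhds (s := Ioi 0))
      simpa using this
    refine le_of_tendsto hlim ?_
    filter_upwards [Ioo_mem_nhdsGT hsw] with η hη using hstep η hη.1 hη.2
  -- comparison of the two normal laws at `x = 1`
  set ρ := R / s ^ 2 with hρ
  have hρ0 : 0 ≤ ρ := by positivity
  have hρ1 : ρ ≤ 1 := by
    rw [hρ, div_le_one (by positivity)]; nlinarith
  have hKw : K = w * (1 - ρ) := by rw [hK, hw, hρ]; field_simp
  -- That is, (1 - ρ)^{-1/2} ≥ 1 + ρ/2. Since ρ ≤ 1, the interval [1, 1 + ρ/2] lies in [0, 2], where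
  -- the density is at least φ(2).
  have hratio : 1 + ρ / 2 ≤ √w / √K := by
    rw [le_div_iff₀ (Real.sqrt_pos.2 hK0)]
    apply Real.le_sqrt_of_sq_le
    rw [mul_pow, Real.sq_sqrt hK0.le, hKw]
    have : (1 + ρ / 2) ^ 2 * (1 - ρ) ≤ 1 := by nlinarith [mul_nonneg hρ0 hρ0, pow_nonneg hρ0 3]
    calc (1 + ρ / 2) ^ 2 * (w * (1 - ρ)) = w * ((1 + ρ / 2) ^ 2 * (1 - ρ)) := by ring
      _ ≤ w * 1 := mul_le_mul_of_nonneg_left this hw0.le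
      _ = w := mul_one w
  have hgap := stdCDF_sub_ge (x := 1) (y := 1 + ρ / 2) (m := stdPDF 2) (by linarith)
    (fun t ht => stdPDF_le_stdPDF (by
      rw [abs_of_nonneg (by linarith [ht.1]), abs_of_nonneg (by norm_num)]
      linarith [ht.2]))
  have hmono := monotone_stdCDF hratio
  have hD := le_normalDistance (P := P) α ε n 1
  rw [one_mul] at hD
  have hD2 := (le_abs_self _).trans hD
  have hfin : stdPDF 2 / (2 * s ^ 2) * R = stdPDF 2 * (1 + ρ / 2 - 1) := by
    rw [hρ]; field_simp; ring
  rw [hfin]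
  linarith

end Gaussian

/-! ### An example in which the bias dominates. -/

/-- Coefficients decaying like `j^{-5/4}`. -/
def slowCoeff (j : ℕ) : ℝ := ((j : ℝ) + 1) ^ (-(5 / 4) : ℝ)

lemma slowCoeff_nonneg (j : ℕ) : 0 ≤ slowCoeff j := by unfold slowCoeff; positivity

lemma slowCoeff_zero : slowCoeff 0 = 1 := by simp [slowCoeff]

lemma summable_slowCoeff : Summable slowCoeff := by
  have h : Summable fun j : ℕ => (j : ℝ) ^ (-(5 / 4) : ℝ) :=
    Real.summable_nat_rpow.2 (by norm_num)
  have h1 := (summable_nat_add_iff 1).2 h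
  refine h1.congr fun j => ?_
  simp [slowCoeff]

lemma isAdmissibleCoeff_slowCoeff : IsAdmissibleCoeff slowCoeff := by
  refine ⟨summable_slowCoeff.abs, (summable_slowCoeff.tsum_pos slowCoeff_nonneg 0 ?_).ne'⟩
  rw [slowCoeff_zero]; norm_num

/-- Each of the first n terms is (i+1)(i+2)^{-5/4} ≥ (i+2)^{-1/4}/2, and i + 2 ≤ 16n, where 16 is
chosen for its fourth root 2. The resulting n^{-1/4} dominates n^{-1/2}; any decay exponent strictly
between 1 and 3/2 would have this effect. -/
lemma le_biasTerm_slowCoeff {n : ℕ} (hn : 1 ≤ n) :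
    (n : ℝ) ^ (-(1 / 4) : ℝ) / 4 ≤ biasTerm slowCoeff n := by
  have hn0 : (0 : ℝ) < n := by positivity
  have hn1 : (1 : ℝ) ≤ n := by exact_mod_cast hn
  have hterm : ∀ i ∈ Finset.range n,
      (n : ℝ) ^ (-(1 / 4) : ℝ) / 4 ≤ min ((i : ℝ) + 1) n * |slowCoeff (i + 1)| := by
    intro i hi
    have hin : (i : ℝ) + 1 ≤ n := by exact_mod_cast Finset.mem_range.1 hi
    have hi0 : (0 : ℝ) ≤ i := Nat.cast_nonneg i
    rw [min_eq_left hin, abs_of_nonneg (slowCoeff_nonneg _), slowCoeff]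
    push_cast
    have hpos : (0 : ℝ) < (i : ℝ) + 1 + 1 := by linarith
    have e1 : ((i : ℝ) + 1 + 1) * ((i : ℝ) + 1 + 1) ^ (-(5 / 4) : ℝ)
        = ((i : ℝ) + 1 + 1) ^ (-(1 / 4) : ℝ) := by
      nth_rewrite 1 [← Real.rpow_one ((i : ℝ) + 1 + 1)]
      rw [← Real.rpow_add hpos]; norm_num
    have e2 : (16 * (n : ℝ)) ^ (-(1 / 4) : ℝ) ≤ ((i : ℝ) + 1 + 1) ^ (-(1 / 4) : ℝ) :=
      Real.rpow_le_rpow_of_nonpos hpos (by linarith) (by norm_num)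
    have e3 : (16 * (n : ℝ)) ^ (-(1 / 4) : ℝ) = (n : ℝ) ^ (-(1 / 4) : ℝ) / 2 := by
      rw [Real.mul_rpow (by norm_num) hn0.le,
        show (16 : ℝ) = 2 ^ (4 : ℝ) by norm_num, ← Real.rpow_mul (by norm_num)]
      norm_num
      ring
    have hp : 0 ≤ ((i : ℝ) + 1 + 1) ^ (-(5 / 4) : ℝ) := by positivity
    nlinarith
  have hs : Summable fun j : ℕ => min ((j : ℝ) + 1) n * |slowCoeff (j + 1)| := by
    have := (summable_nat_add_iff 1).2 (summable_min_mul summable_slowCoeff.abs n)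
    simpa using this
  have hsum := (Finset.sum_le_sum hterm).trans
    (hs.sum_le_tsum (Finset.range n) fun j _ => by positivity)
  rw [Finset.sum_const, Finset.card_range, nsmul_eq_mul] at hsum
  rw [biasTerm, inv_mul_eq_div, le_div_iff₀ hn0]
  linarith

lemma tendsto_sqrt_mul_biasTerm_slowCoeff :
    Tendsto (fun n : ℕ => √(n : ℝ) * biasTerm slowCoeff n) atTop atTop := by
  have h1 : Tendsto (fun n : ℕ => (n : ℝ) ^ (1 / 4 : ℝ) / 4) atTop atTop :=
    ((tendsto_rpow_atTop (by norm_num)).comp tendsto_natCast_atTop_atTop).atTop_div_const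
      (by norm_num)
  refine tendsto_atTop_mono' _ ?_ h1
  filter_upwards [eventually_ge_atTop 1] with n hn
  have hn0 : (0 : ℝ) < n := by positivity
  calc (n : ℝ) ^ (1 / 4 : ℝ) / 4 = √(n : ℝ) * ((n : ℝ) ^ (-(1 / 4) : ℝ) / 4) := by
        rw [Real.sqrt_eq_rpow, ← mul_div_assoc, ← Real.rpow_add hn0]; norm_num
    _ ≤ _ := mul_le_mul_of_nonneg_left (le_biasTerm_slowCoeff hn) (by positivity)

lemma rate_slowCoeff_le {n : ℕ} (hn : 1 ≤ n) :
    rate slowCoeff n ≤ 5 * biasTerm slowCoeff n := by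
  have h1 := le_biasTerm_slowCoeff hn
  have h2 : (n : ℝ) ^ (-(1 / 2) : ℝ) ≤ (n : ℝ) ^ (-(1 / 4) : ℝ) :=
    Real.rpow_le_rpow_of_exponent_le (by exact_mod_cast hn) (by norm_num)
  rw [rate]
  linarith

lemma isInnovationSequence_gaussian :
    IsInnovationSequence (Measure.infinitePi fun _ : ℤ => gaussianReal 0 1)
      (fun i ω => ω i) := by
  refine isInnovationSequence_infinitePi _ integral_id_gaussianReal ?_ ?_
  · have h := variance_of_integral_eq_zero (X := fun x : ℝ => x) (μ := gaussianReal 0 1)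
      (by fun_prop) integral_id_gaussianReal
    rw [variance_fun_id_gaussianReal] at h
    simpa using h.symm
  · exact (memLp_id_gaussianReal (μ := 0) (v := 1) 3).integrable_abs_pow_three

theorem attainsRate_gaussian :
    AttainsRate (Measure.infinitePi fun _ : ℤ => gaussianReal 0 1) slowCoeff
      (fun i ω => ω i) := by
  have hs : 0 < longRunStd slowCoeff := abs_pos.2 isAdmissibleCoeff_slowCoeff.tsum_ne_zero
  have hp := stdPDF_pos 2
  refine ⟨stdPDF 2 / (2 * longRunStd slowCoeff ^ 2) / 5, by positivity, fun n hn => ?_⟩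
  refine le_trans ?_ (biasTerm_le_normalDistance_of_gaussian isInnovationSequence_gaussian
    (fun i => measurable_pi_apply i)
    (fun i => (measurePreserving_eval_infinitePi (fun _ : ℤ => gaussianReal 0 1) i).map_eq)
    slowCoeff_nonneg slowCoeff_zero summable_slowCoeff hn)
  rw [div_mul_eq_mul_div, mul_div_assoc]
  refine mul_le_mul_of_nonneg_left ?_ (by positivity)
  linarith [rate_slowCoeff_le hn]

lemma isInnovationSequence_rademacher :
    IsInnovationSequence (Measure.infinitePi fun _ : ℤ => rademacher) (fun i ω => ω i) := by
  refine isInnovationSequence_infinitePi _ ?_ ?_ (integrable_rademacher _)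
  · rw [integral_rademacher fun x => x]; norm_num
  · rw [integral_rademacher fun x => x ^ 2]; norm_num

end Sharpness

end

/-! ### The upper bound and the two examples combined. -/

theorem proposition5p1 :
    -- Upper bound; the constant depends only on `∑ |α_j|`, `|∑ α_j|` and `E|ε_0|³`.
    (∃ C : ℝ → ℝ → ℝ → ℝ,
      ∀ (Ω : Type*) [MeasurableSpace Ω] (P : Measure Ω) [IsProbabilityMeasure P]
        (α : ℕ → ℝ) (ε : ℤ → Ω → ℝ),
        IsAdmissibleCoeff α → IsInnovationSequence P ε →
          -- the series defining `X_k` converges absolutely almost surely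
          (∀ k : ℤ, ∀ᵐ ω ∂P, Summable fun j : ℕ => |α j * ε (k - (j : ℤ)) ω|) ∧
          ∀ n : ℕ, 1 ≤ n →
            normalDistance P α ε n
              ≤ C (∑' j, |α j|) (longRunStd α) (∫ ω, |ε 0 ω| ^ 3 ∂P) * rate α n) ∧
    -- Sharpness when the second term of the rate dominates.
    (∃ (Ω : Type) (_ : MeasurableSpace Ω) (P : Measure Ω) (_ : IsProbabilityMeasure P)
        (α : ℕ → ℝ) (ε : ℤ → Ω → ℝ),
        IsAdmissibleCoeff α ∧ IsInnovationSequence P ε ∧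
          Tendsto (fun n : ℕ => √(n : ℝ) * biasTerm α n) atTop atTop ∧ AttainsRate P α ε) ∧
    -- Sharpness when the first term of the rate dominates.
    (∃ (Ω : Type) (_ : MeasurableSpace Ω) (P : Measure Ω) (_ : IsProbabilityMeasure P)
        (α : ℕ → ℝ) (ε : ℤ → Ω → ℝ),
        IsAdmissibleCoeff α ∧ IsInnovationSequence P ε ∧
          (∃ K : ℝ, ∀ n : ℕ, √(n : ℝ) * biasTerm α n ≤ K) ∧ AttainsRate P α ε) := by
  refine ⟨⟨fun A s β => 220 * β * A / s + 8 * A / s ^ 2, ?_⟩, ?_, ?_⟩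
  · intro Ω _ P _ α ε hα hε
    exact ⟨fun k => hε.ae_summable hα.summable_abs k, fun n hn => hε.normalDistance_le hα hn⟩
  · exact ⟨ℤ → ℝ, inferInstance, Measure.infinitePi fun _ : ℤ => gaussianReal 0 1, inferInstance,
      slowCoeff, fun i ω => ω i, isAdmissibleCoeff_slowCoeff, isInnovationSequence_gaussian,
      tendsto_sqrt_mul_biasTerm_slowCoeff, attainsRate_gaussian⟩
  · exact ⟨ℤ → ℝ, inferInstance, Measure.infinitePi fun _ : ℤ => rademacher, inferInstance,
      unitCoeff, fun i ω => ω i, isAdmissibleCoeff_unitCoeff, isInnovationSequence_rademacher,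
      ⟨0, fun n => by rw [biasTerm_unitCoeff, mul_zero]⟩, attainsRate_rademacher⟩
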